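/- Let $\Omega=\mathbb{T}^2=(\mathbb{R}/2\pi\mathbb{Z})^2$, let $\dot L^2$ be the space of real mean-zero functions in $L^2(\Omega)$ with norm $\|\cdot\|_2$, and let $\|\cdot\|_{H^1}$ be the norm $\|u\|_{H^1}^2=\|u\|_2^2+\|\nabla u\|_2^2$. For $\nu>0$ and a time step $k>0$ consider the semi-implicit scheme $$\frac{\omega^{n+1}-\omega^n}{k}+\nabla^\perp\psi^n\cdot\nabla\omega^n-\nu\Delta\omega^{n+1}=f^n,\qquad -\Delta\psi^n=\omega^n,\qquad \omega^n,\psi^n,f^n\in\dot L^2,$$ with $\nabla^\perp\psi=(-\partial_y\psi,\partial_x\psi)$, understood in the sense of distributions on $\Omega$, where $\nabla^\perp\psi^n\cdot\nabla\omega^n=\nabla\cdot(\omega^n\nabla^\perp\psi^n)$. **Theorem.** (1) The scheme defines a discrete dynamical system on $\dot L^2$: for all $\nu,k>0$ and all $\omega^n,f^n\in\dot L^2$ there is exactly one $\omega^{n+1}\in\dot L^2$ satisfying the scheme, and it depends continuously on $(\omega^n,f^n)\in\dot L^2\times\dot L^2$; in particular, for a forcing $f^n=g$ independent of $n$, the iterates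 form a continuous discrete semigroup on $\dot L^2$. (2) The scheme is long time stable in $L^2$ and in $H^1$: there are functions $k_0>0$, $M_0$, $T$ of $(\|\omega_0\|_2,\nu,\|f\|_\infty)$ and a function $M_1$ of $(\nu,\|f\|_\infty)$ only, such that the following holds for every $\nu>0$, every $f\in L^\infty(\mathbb{R}_+;\dot L^2)$ with norm $\|f\|_\infty$ and every $\omega_0\in\dot L^2$. If $0<k<k_0(\|\omega_0\|_2,\nu,\|f\|_\infty)$, if the discrete values $f^n\in\dot L^2$ of the forcing satisfy $\|f^n\|_2\le\|f\|_\infty$ for all $n\ge0$, and if $(\omega^n)_{n\ge0}$ is the solution of the scheme with $\omega^0=\omega_0$, then $$\|\omega^n\|_2\le M_0(\|\omega_0\|_2,\nu,\|f\|_\infty)\quad\text{for all } n\ge0,$$ $$\omega^n\in H^1(\Omega)\ \text{ and }\ \|\omega^n\|_{H^1}\le M_1(\nu,\|f\|_\infty)\quad\text{for all } n \text{ with } nk\ge T(\|\omega_0\|_2,\nu,\|f\|_\infty),$$ that is, for all $n\ge N:=\lceil T/k\rceil$. -/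

import Mathlib

open MeasureTheory Set
open scoped ENNReal

namespace TorusNSE

instance factTwoPiPos : Fact (0 < 2 * Real.pi) := ⟨Real.two_pi_pos⟩

/-- The torus `(ℝ / 2πℤ)²`. Its `volume` is Lebesgue measure of total mass `(2π)²`. -/
abbrev Torus : Type := Fin 2 → AddCircle (2 * Real.pi)

/-- Real `L²(Ω)` of the periodic box `Ω = (0, 2π)²`, with `‖u‖² = ∫_Ω |u|² dx`. -/
abbrev L2 : Type := Lp ℝ 2 (volume : Measure Torus)

/-- The mean-zero subspace of `L²`. -/
def meanZero : Submodule ℝ L2 where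
  carrier := {u | ∫ x, u x = 0}
  zero_mem' := by
    simp
  add_mem' := by
    intro u v hu hv
    have hu' : Integrable (fun x => u x) := (Lp.memLp u).integrable one_le_two
    have hv' : Integrable (fun x => v x) := (Lp.memLp v).integrable one_le_two
    have h : ∫ x, (u + v) x = ∫ x, (u x + v x) := integral_congr_ae (Lp.coeFn_add u v)
    have hu0 : ∫ x, u x = 0 := hu
    have hv0 : ∫ x, v x = 0 := hv
    show ∫ x, (u + v) x = 0
    rw [h, integral_add hu' hv', hu0, hv0, add_zero]
  smul_mem' := by
    intro c u hu
    have h : ∫ x, (c • u) x = ∫ x, c * u x := integral_congr_ae (Lp.coeFn_smul c u)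
    have hu0 : ∫ x, u x = 0 := hu
    show ∫ x, (c • u) x = 0
    rw [h, integral_const_mul, hu0, mul_zero]

/-- The phase space: mean-zero `L²` functions on the torus, with the `L²` norm. -/
abbrev L2dot : Type := meanZero

/-- Smooth functions on the torus, i.e. those whose `2π`-periodic lift to `ℝ²` is `C^∞`. -/
def IsSmooth (φ : Torus → ℝ) : Prop :=
  ContDiff ℝ ((⊤ : ℕ∞) : WithTop ℕ∞) (fun x : Fin 2 → ℝ => φ (fun i => (x i : AddCircle (2 * Real.pi))))

/-- The classical partial derivative `∂ᵢφ` of a function on the torus. -/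
noncomputable def partialDeriv (i : Fin 2) (φ : Torus → ℝ) (x : Torus) : ℝ :=
  deriv (fun t : ℝ => φ (x + Pi.single i (t : AddCircle (2 * Real.pi)))) 0

/-- The classical Laplacian of a function on the torus. -/
noncomputable def laplacian (φ : Torus → ℝ) (x : Torus) : ℝ :=
  ∑ i, partialDeriv i (partialDeriv i φ) x

/-- `D = (D 0, D 1)` is the weak (distributional) gradient of `u`, with `D i ∈ L²`;
such a `D` exists exactly when `u` is in the periodic Sobolev space `H¹`. -/
def IsWeakGradient (u : L2) (D : Fin 2 → L2) : Prop :=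
  ∀ i, ∀ φ : Torus → ℝ, IsSmooth φ →
    ∫ x, u x * partialDeriv i φ x = -∫ x, D i x * φ x

/-- `u ∈ H¹` and `‖u‖_{H¹} = (‖u‖₂² + ‖∂₀u‖₂² + ‖∂₁u‖₂²)^{1/2} ≤ M`. -/
def H1NormLE (u : L2) (M : ℝ) : Prop :=
  ∃ D : Fin 2 → L2, IsWeakGradient u D ∧ Real.sqrt (‖u‖ ^ 2 + ∑ i, ‖D i‖ ^ 2) ≤ M

/-- `-Δψ = ω` on the torus in the sense of distributions. For `ω` of mean zero there is exactly
one mean-zero solution `ψ`. -/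
def IsStreamfunction (ω ψ : L2dot) : Prop :=
  ∀ φ : Torus → ℝ, IsSmooth φ →
    -∫ x, (ψ : L2) x * laplacian φ x = ∫ x, (ω : L2) x * φ x

/-- One step of the semi-implicit scheme:
`(ω' - ω) / k + ∇^⊥ψ·∇ω - ν Δω' = g` in the sense of distributions, where `-Δψ = ω` and
`∇^⊥ψ = (-∂₁ψ, ∂₀ψ)`. As `∇^⊥ψ` is divergence free, `∇^⊥ψ·∇ω = ∇·(ω ∇^⊥ψ)` is the
distribution `φ ↦ -∫ ω ∇^⊥ψ·∇φ`, which makes sense for every `ω ∈ L²`. -/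
def IsSchemeStep (ν k : ℝ) (g ω ω' : L2dot) : Prop :=
  ∃ (ψ : L2dot) (D : Fin 2 → L2), IsStreamfunction ω ψ ∧ IsWeakGradient ψ D ∧
    ∀ φ : Torus → ℝ, IsSmooth φ →
      (∫ x, (((ω' : L2) x - (ω : L2) x) / k) * φ x)
        - (∫ x, (ω : L2) x * (-(D 1 x) * partialDeriv 0 φ x + D 0 x * partialDeriv 1 φ x))
        - ν * (∫ x, (ω' : L2) x * laplacian φ x)
      = ∫ x, (g : L2) x * φ x

/-- `ω 0, ω 1, …` is a solution of the scheme with time step `k` and forcing `g n` in step `n`. -/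
def IsSchemeSolution (ν k : ℝ) (g ω : ℕ → L2dot) : Prop :=
  ∀ n, IsSchemeStep ν k (g n) (ω n) (ω (n + 1))

/-- `f ∈ L^∞(ℝ₊; L²)` with values of mean zero. -/
def IsForcing (f : ℝ → L2dot) : Prop :=
  MemLp f ∞ (volume.restrict (Ici (0 : ℝ)))

/-- The norm `‖f‖_∞` of `L^∞(ℝ₊; L²)`. -/
noncomputable def forcingNorm (f : ℝ → L2dot) : ℝ :=
  (eLpNorm f ∞ (volume.restrict (Ici (0 : ℝ)))).toReal

end TorusNSE

/-!
Everything takes place in Fourier variables. A mean-zero `L²` function is a square summable, conjugate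
symmetric sequence `hat ω` that vanishes at `0`, and testing against smooth functions amounts to
testing against characters. So the scheme is, mode by mode, the explicit formula `schemeStep`:
`hat ω' m = (hat ω m + k (hat g m - B m)) / (1 + k ν |m|²)`, where `B = advection (hat ω) (hat ω)` is
the transport term (`isSchemeStep_iff`, `isSchemeStep_iff_hat_eq`).

*The dynamical system.* For `ω ∈ L²`, the flux `ω ∇^⊥ψ` need not be in `L²`, but it is in `H^{-1/2}`:
this is the Cauchy–Schwarz inequality in the convolution, together with
`∑ |m|⁻¹ |m - l|⁻² ≤ 2 ∑ |m|⁻³` (`tsum_invNorm_mul_velConv_sq_le`). The resolvent of the viscous term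
gains two derivatives, which is more than the divergence and the loss of `1/2` require. Hence
`schemeStep` maps `L²` to itself and is Lipschitz continuous on bounded sets
(`normSq_schemeStep_sub_le`).

*Stability in `L²`.* Multiply the scheme by `2 k ω'`. The implicit Euler method produces the numerical
dissipation `‖ω' - ω‖²`. The trilinear term with `ω'` twice vanishes, as the velocity is divergence
free (`hasSum_re_conj_mul_advection`); what remains of the transport term is bounded by
`sup |u| ‖∇ω'‖ ‖ω' - ω‖`, where `u` is the velocity of `ω`. It is absorbed by the two dissipations as
soon as `k sup |u|² ≲ ν` (`normSq_add_gradSq_schemeStep_le`). For `ω ∈ L²` the velocity need not be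
bounded, but it is so if `ω` is itself the result of a step, and then `sup |u|² = O(k^{-1/2})` in terms
of the `L²` norm of the iterate before (`velSum_schemeStep_sq_le`). So the condition holds for small
`k`, as long as the iterates stay in a fixed ball, and the resulting energy inequality in turn keeps
them there and makes them decay geometrically to a ball of radius depending on `ν` and the forcing
only (`norm_sq_le_of_small_step`). For the initial step the crude estimate from the Lipschitz bound is
enough.

*Stability in `H¹`.* The energy inequality also bounds `k ∑ ‖∇ω‖²` over windows of length about one.
In one step, `‖∇ω‖²` grows by at most `O(k) (‖g‖² + ‖∇ω‖⁴)` (`gradSq_schemeStep_le`), since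
`sup |u|² ≲ ‖∇ω‖²` (`velSum_sq_le_gradSq`). A discrete uniform Gronwall lemma (`uniform_gronwall`) then
bounds `‖∇ω‖²` at the end of each window by a constant that does not depend on the initial value.
-/

namespace TorusNSE

open scoped ComplexConjugate

/-! ### Fourier series on the torus -/

/-- The wave vectors of the torus. -/
abbrev Freq : Type := Fin 2 → ℤ

/-- The character `x ↦ exp (i m · x)` of the torus. -/
noncomputable def character (m : Freq) : C(Torus, ℂ) where
  toFun x := ∏ i, fourier (m i) (x i)
  continuous_toFun := by fun_prop

lemma character_apply (m : Freq) (x : Torus) : character m x = ∏ i, fourier (m i) (x i) := rfl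

lemma character_neg (m : Freq) (x : Torus) : character (-m) x = conj (character m x) := by
  simp only [character_apply, Pi.neg_apply, fourier_neg, map_prod]

lemma character_add (m n : Freq) (x : Torus) :
    character (m + n) x = character m x * character n x := by
  simp only [character_apply, Pi.add_apply, fourier_add, ← Finset.prod_mul_distrib]

lemma character_zero : character 0 = 1 := by
  ext x
  simp [character_apply]

lemma norm_character_apply (m : Freq) (x : Torus) : ‖character m x‖ = 1 := by
  rw [character_apply, norm_prod]
  exact Finset.prod_eq_one fun i _ => by rw [fourier_apply]; exact Circle.norm_coe _

lemma character_single (z : Torus) (i : Fin 2) :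
    character (Pi.single i 1) z = fourier 1 (z i) := by
  rw [character_apply, Finset.prod_eq_single i]
  · simp
  · intro j _ hj
    simp [Pi.single_eq_of_ne hj]
  · simp

/-- Trigonometric polynomials, as a star subalgebra of the continuous functions. -/
noncomputable def trigPolynomials : StarSubalgebra ℂ C(Torus, ℂ) where
  toSubalgebra := Algebra.adjoin ℂ (range character)
  star_mem' := by
    change Algebra.adjoin ℂ (range character) ≤ star (Algebra.adjoin ℂ (range character))
    refine Algebra.adjoin_le ?_
    rintro _ ⟨n, rfl⟩
    refine Algebra.subset_adjoin ⟨-n, ?_⟩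
    ext1 x
    simp only [character_neg, starRingEnd_apply, ContinuousMap.star_apply]

lemma trigPolynomials_toSubmodule :
    trigPolynomials.toSubalgebra.toSubmodule = Submodule.span ℂ (range character) := by
  apply Algebra.adjoin_eq_span_of_subset
  refine .trans (fun x ↦ Submonoid.closure_induction (fun _ ↦ id) ⟨0, ?_⟩ ?_) Submodule.subset_span
  · exact character_zero
  · rintro _ _ _ _ ⟨m, rfl⟩ ⟨n, rfl⟩
    refine ⟨m + n, ?_⟩
    ext z
    simp [character_add]

lemma trigPolynomials_separatesPoints : trigPolynomials.SeparatesPoints := by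
  intro x y hxy
  rw [Ne, funext_iff, not_forall] at hxy
  obtain ⟨i, hi⟩ := hxy
  refine ⟨_, ⟨character (Pi.single i 1), Algebra.subset_adjoin ⟨Pi.single i 1, rfl⟩, rfl⟩, ?_⟩
  dsimp only
  rw [character_single, character_single, fourier_one, fourier_one]
  exact fun h => hi (AddCircle.injective_toCircle Real.two_pi_pos.ne' (Circle.ext h))

lemma span_character_closure_eq_top :
    (Submodule.span ℂ (range character)).topologicalClosure = ⊤ := by
  rw [← trigPolynomials_toSubmodule]
  exact congr_arg (Subalgebra.toSubmodule <| StarSubalgebra.toSubalgebra ·)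
    (ContinuousMap.starSubalgebra_topologicalClosure_eq_top_of_separatesPoints _
      trigPolynomials_separatesPoints)

lemma integral_character (m : Freq) :
    ∫ x, character m x = if m = 0 then ((2 * Real.pi : ℝ) : ℂ) ^ 2 else 0 := by
  have h1 : ∀ n : ℤ, ∫ x : AddCircle (2 * Real.pi), (fourier n x : ℂ)
      = if n = 0 then ((2 * Real.pi : ℝ) : ℂ) else 0 := by
    intro n
    have h := fourierCoeff_fourier (T := 2 * Real.pi) n
    have h0 := congrFun h 0
    simp only [fourierCoeff, neg_zero, fourier_zero, one_smul] at h0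
    rw [AddCircle.integral_haarAddCircle, inv_smul_eq_iff₀ Real.two_pi_pos.ne'] at h0
    rw [h0]
    by_cases hn : n = 0
    · subst hn; simp
    · simp [hn, Ne.symm hn]
  simp only [character_apply]
  rw [MeasureTheory.integral_fintype_prod_volume_eq_prod
    (fun i (y : AddCircle (2 * Real.pi)) => (fourier (m i) y : ℂ))]
  simp only [h1]
  split_ifs with h
  · subst h; simp
  · obtain ⟨i, hi⟩ := Function.ne_iff.mp h
    exact Finset.prod_eq_zero (Finset.mem_univ i) (by simpa using hi)

/-- The characters as elements of complex `L²`, divided by `2π` so as to have norm one. -/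
noncomputable def characterLp (m : Freq) : Lp ℂ 2 (volume : Measure Torus) :=
  ((2 * Real.pi : ℝ) : ℂ)⁻¹ • ContinuousMap.toLp (E := ℂ) 2 volume ℂ (character m)

lemma two_pi_complex_ne_zero : ((2 * Real.pi : ℝ) : ℂ) ≠ 0 :=
  Complex.ofReal_ne_zero.mpr Real.two_pi_pos.ne'

lemma orthonormal_characterLp : Orthonormal ℂ characterLp := by
  rw [orthonormal_iff_ite]
  intro m n
  have h : ∫ x, conj (character m x) * character n x
      = if m = n then ((2 * Real.pi : ℝ) : ℂ) ^ 2 else 0 := by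
    simp only [← character_neg, ← character_add, integral_character]
    congr 1
    rw [neg_add_eq_zero]
  rw [characterLp, characterLp, inner_smul_left, inner_smul_right, ContinuousMap.inner_toLp]
  have h' : ∫ x, character n x * conj (character m x)
      = if m = n then ((2 * Real.pi : ℝ) : ℂ) ^ 2 else 0 := by
    rw [← h]
    congr 1
    ext x
    ring
  rw [h']
  split_ifs
  · rw [map_inv₀, Complex.conj_ofReal]
    field_simp [two_pi_complex_ne_zero]
  · simp

lemma span_characterLp_closure_eq_top :
    (Submodule.span ℂ (range characterLp)).topologicalClosure = ⊤ := by
  have h := (ContinuousMap.toLp_denseRange ℂ (volume : Measure Torus) ℂ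
    (p := 2) (by simp)).topologicalClosure_map_submodule span_character_closure_eq_top
  rw [← h, Submodule.map_span]
  congr 1
  apply le_antisymm
  · rw [Submodule.span_le]
    rintro _ ⟨m, rfl⟩
    exact Submodule.smul_mem _ _ (Submodule.subset_span ⟨_, ⟨m, rfl⟩, rfl⟩)
  · rw [Submodule.span_le]
    rintro _ ⟨_, ⟨m, rfl⟩, rfl⟩
    have : (ContinuousMap.toLp (E := ℂ) 2 volume ℂ (character m) : Lp ℂ 2 (volume : Measure Torus))
        = ((2 * Real.pi : ℝ) : ℂ) • characterLp m := by
      rw [characterLp, smul_smul, mul_inv_cancel₀ two_pi_complex_ne_zero, one_smul]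
    exact this ▸ Submodule.smul_mem _ _ (Submodule.subset_span ⟨m, rfl⟩)

/-- The orthonormal basis `(2π)⁻¹ exp (i m · x)` of complex `L²` of the torus. -/
noncomputable def fourierBasis : HilbertBasis Freq ℂ (Lp ℂ 2 (volume : Measure Torus)) :=
  HilbertBasis.mk orthonormal_characterLp span_characterLp_closure_eq_top.ge

/-- The Fourier coefficient `(2π)⁻¹ ∫ f exp (-i m · x)`. With this normalization, Parseval's
identity holds without a constant. -/
noncomputable def coef (f : Torus → ℂ) (m : Freq) : ℂ :=
  ((2 * Real.pi : ℝ) : ℂ)⁻¹ * ∫ x, character (-m) x * f x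

lemma coef_congr {f g : Torus → ℂ} (h : f =ᵐ[volume] g) (m : Freq) : coef f m = coef g m := by
  unfold coef
  congr 1
  exact integral_congr_ae (h.mono fun x hx => by simp only [hx])

lemma fourierBasis_repr (f : Lp ℂ 2 (volume : Measure Torus)) (m : Freq) :
    fourierBasis.repr f m = coef f m := by
  rw [HilbertBasis.repr_apply_apply, fourierBasis, HilbertBasis.coe_mk, characterLp,
    inner_smul_left, L2.inner_def, map_inv₀, Complex.conj_ofReal, coef]
  congr 1
  refine integral_congr_ae ?_
  filter_upwards [ContinuousMap.coeFn_toLp (p := 2) (𝕜 := ℂ) volume (character m)] with x hx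
  rw [hx, RCLike.inner_apply, character_neg, mul_comm]

/-- Parseval's identity. -/
lemma hasSum_conj_coef_mul_coef {f g : Torus → ℂ} (hf : MemLp f 2 volume) (hg : MemLp g 2 volume) :
    HasSum (fun m => conj (coef f m) * coef g m) (∫ x, conj (f x) * g x) := by
  have h := fourierBasis.hasSum_inner_mul_inner hf.toLp hg.toLp
  rw [L2.inner_def] at h
  convert! h using 1
  · funext m
    rw [← coef_congr hf.coeFn_toLp m, ← coef_congr hg.coeFn_toLp m, ← fourierBasis_repr,
      ← fourierBasis_repr, HilbertBasis.repr_apply_apply, HilbertBasis.repr_apply_apply,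
      inner_conj_symm]
  · refine integral_congr_ae ?_
    filter_upwards [hf.coeFn_toLp, hg.coeFn_toLp] with x hx hy
    rw [hx, hy, RCLike.inner_apply, mul_comm]

lemma memLp_ofReal (u : L2) : MemLp (fun x => ((u x : ℝ) : ℂ)) 2 (volume : Measure Torus) :=
  (Lp.memLp u).ofReal

/-- The sequence of Fourier coefficients of a real `L²` function. -/
noncomputable def hat (u : L2) (m : Freq) : ℂ := coef (fun x => ((u x : ℝ) : ℂ)) m

lemma coef_ofReal_neg (f : Torus → ℝ) (m : Freq) :
    coef (fun x => (f x : ℂ)) (-m) = conj (coef (fun x => (f x : ℂ)) m) := by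
  unfold coef
  rw [map_mul, map_inv₀, Complex.conj_ofReal, ← integral_conj]
  congr 2
  ext x
  rw [map_mul, Complex.conj_ofReal, ← character_neg]

lemma hat_neg (u : L2) (m : Freq) : hat u (-m) = conj (hat u m) := coef_ofReal_neg _ m

lemma hasSum_norm_hat_sq (u : L2) : HasSum (fun m => ‖hat u m‖ ^ 2) (‖u‖ ^ 2) := by
  have h := hasSum_conj_coef_mul_coef (memLp_ofReal u) (memLp_ofReal u)
  have h2 : (∫ x, conj ((u x : ℝ) : ℂ) * ((u x : ℝ) : ℂ)) = ((‖u‖ ^ 2 : ℝ) : ℂ) := by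
    have : ∀ x, conj ((u x : ℝ) : ℂ) * ((u x : ℝ) : ℂ) = ((u x * u x : ℝ) : ℂ) := by
      intro x; rw [Complex.conj_ofReal]; push_cast; ring
    simp only [this]
    rw [integral_complex_ofReal, ← real_inner_self_eq_norm_sq, L2.inner_def]
    congr 1
  rw [h2] at h
  have h3 := Complex.hasSum_re h
  rw [Complex.ofReal_re] at h3
  refine h3.congr_fun fun m => ?_
  rw [mul_comm, Complex.mul_conj, Complex.ofReal_re, Complex.normSq_eq_norm_sq]
  rfl

lemma integrable_character_mul {f : Torus → ℂ} (hf : Integrable f volume) (m : Freq) :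
    Integrable (fun x => character m x * f x) volume :=
  hf.bdd_mul (c := 1) (character m).continuous.aestronglyMeasurable
    (Filter.Eventually.of_forall fun x => (norm_character_apply m x).le)

lemma integrable_ofReal (u : L2) : Integrable (fun x => ((u x : ℝ) : ℂ)) volume :=
  (memLp_ofReal u).integrable one_le_two

lemma hat_add (u v : L2) (m : Freq) : hat (u + v) m = hat u m + hat v m := by
  have h : hat (u + v) m = coef (fun x => ((u x : ℝ) : ℂ) + ((v x : ℝ) : ℂ)) m := by
    refine coef_congr ?_ m
    filter_upwards [Lp.coeFn_add u v] with x hx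
    rw [hx, Pi.add_apply, Complex.ofReal_add]
  rw [h]
  simp only [hat, coef, mul_add]
  rw [integral_add (integrable_character_mul (integrable_ofReal u) _)
    (integrable_character_mul (integrable_ofReal v) _), mul_add]

lemma hat_neg' (u : L2) (m : Freq) : hat (-u) m = -hat u m := by
  have h : hat (-u) m = coef (fun x => -((u x : ℝ) : ℂ)) m := by
    refine coef_congr ?_ m
    filter_upwards [Lp.coeFn_neg u] with x hx
    rw [hx, Pi.neg_apply, Complex.ofReal_neg]
  rw [h]
  simp [hat, coef, integral_neg]

lemma hat_sub (u v : L2) (m : Freq) : hat (u - v) m = hat u m - hat v m := by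
  rw [sub_eq_add_neg, hat_add, hat_neg', sub_eq_add_neg]

lemma hat_injective : Function.Injective hat := by
  intro u v h
  have h1 := hasSum_norm_hat_sq (u - v)
  simp only [hat_sub, h, sub_self, norm_zero, ne_eq, OfNat.ofNat_ne_zero, not_false_eq_true,
    zero_pow] at h1
  have h2 := h1.unique hasSum_zero
  rwa [sq_eq_zero_iff, norm_eq_zero, sub_eq_zero] at h2

/-- The Riesz–Fischer theorem for real functions. -/
lemma exists_hat_eq {a : Freq → ℂ} (ha : Summable fun m => ‖a m‖ ^ 2)
    (hsymm : ∀ m, a (-m) = conj (a m)) : ∃ u : L2, hat u = a := by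
  have hmem : Memℓp a 2 := by
    rw [memℓp_gen_iff (by simp)]
    simpa using ha
  set v : Lp ℂ 2 (volume : Measure Torus) := fourierBasis.repr.symm ⟨a, hmem⟩ with hv
  have hva : ∀ m, coef v m = a m := by
    intro m
    rw [← fourierBasis_repr, hv, LinearIsometryEquiv.apply_symm_apply]
  have hre : MemLp (fun x => (v x).re) 2 (volume : Measure Torus) := (Lp.memLp v).re
  have hint : Integrable (fun x => v x) (volume : Measure Torus) :=
    (Lp.memLp v).integrable one_le_two
  refine ⟨hre.toLp, funext fun m => ?_⟩
  have h1 : hat hre.toLp m = coef (fun x => ((v x).re : ℂ)) m := by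
    refine coef_congr ?_ m
    filter_upwards [hre.coeFn_toLp] with x hx
    rw [hx]
  have h2 : coef (fun x => ((v x).re : ℂ)) m = (coef v m + conj (coef v (-m))) / 2 := by
    have hi := integrable_character_mul hint
    have hi' : Integrable (fun x => character (-m) x * conj (v x)) (volume : Measure Torus) := by
      have := (Complex.conjLIE.toContinuousLinearEquiv.toContinuousLinearMap).integrable_comp (hi m)
      refine this.congr (Filter.Eventually.of_forall fun x => ?_)
      simp [character_neg]
    unfold coef
    rw [map_mul, map_inv₀, Complex.conj_ofReal, ← integral_conj, ← mul_add, mul_div_assoc]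
    congr 1
    simp only [map_mul, ← character_neg, neg_neg]
    rw [← integral_add (hi _) hi', ← integral_div]
    congr 1
    ext x
    rw [Complex.re_eq_add_conj]
    ring
  rw [h1, h2, hva, hva, hsymm, Complex.conj_conj]
  ring

lemma coef_character_mul (f : Torus → ℂ) (m j : Freq) :
    coef (fun x => character m x * f x) j = coef f (j - m) := by
  unfold coef
  congr 2
  ext x
  rw [← mul_assoc, ← character_add]
  congr 3
  abel

/-- Fourier coefficients of a product of two `L²` functions are given by convolution. -/
lemma hasSum_coef_mul (u v : L2) (m : Freq) :
    HasSum (fun j => hat u (m - j) * hat v j)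
      (((2 * Real.pi : ℝ) : ℂ) * coef (fun x => ((u x * v x : ℝ) : ℂ)) m) := by
  have hu : MemLp (fun x => character m x * ((u x : ℝ) : ℂ)) 2 (volume : Measure Torus) := by
    refine (memLp_ofReal u).of_le
      ((character m).continuous.aestronglyMeasurable.mul (memLp_ofReal u).1)
      (Filter.Eventually.of_forall fun x => ?_)
    rw [norm_mul, norm_character_apply, one_mul]
  have h := hasSum_conj_coef_mul_coef hu (memLp_ofReal v)
  convert h using 1
  · funext j
    rw [coef_character_mul, ← coef_ofReal_neg, neg_sub]
    rfl
  · rw [coef, mul_inv_cancel_left₀ two_pi_complex_ne_zero]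
    congr 1
    ext x
    rw [map_mul, Complex.conj_ofReal, character_neg]
    push_cast
    ring

lemma mem_meanZero_iff (u : L2) : u ∈ meanZero ↔ hat u 0 = 0 := by
  have h : hat u 0 = ((2 * Real.pi : ℝ) : ℂ)⁻¹ * ((∫ x, u x : ℝ) : ℂ) := by
    rw [hat, coef, neg_zero, character_zero, ← integral_complex_ofReal]
    simp
  rw [h, mul_eq_zero, or_iff_right (inv_ne_zero two_pi_complex_ne_zero),
    Complex.ofReal_eq_zero]
  rfl


/-! ### Smooth test functions -/

/-- The covering map of the torus by the plane. -/
noncomputable def torusMk (x : Fin 2 → ℝ) : Torus := fun i => (x i : AddCircle (2 * Real.pi))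

lemma isOpenQuotientMap_torusMk : IsOpenQuotientMap torusMk :=
  IsOpenQuotientMap.piMap (f := fun _ : Fin 2 => ((↑) : ℝ → AddCircle (2 * Real.pi)))
    fun _ => QuotientAddGroup.isOpenQuotientMap_mk

lemma torusMk_surjective : Function.Surjective torusMk := isOpenQuotientMap_torusMk.surjective

lemma torusMk_add_single (x : Fin 2 → ℝ) (i : Fin 2) (t : ℝ) :
    torusMk x + Pi.single i (t : AddCircle (2 * Real.pi))
      = torusMk (x + t • Pi.single i (1 : ℝ)) := by
  funext j
  by_cases h : j = i
  · subst h; simp [torusMk]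
  · simp [torusMk, h]

namespace IsSmooth

variable {φ : Torus → ℝ}

lemma contDiff_lift (h : IsSmooth φ) :
    ContDiff ℝ ((⊤ : ℕ∞) : WithTop ℕ∞) (fun x => φ (torusMk x)) := h

lemma continuous (h : IsSmooth φ) : Continuous φ :=
  isOpenQuotientMap_torusMk.isQuotientMap.continuous_iff.mpr h.contDiff_lift.continuous

lemma hasDerivAt_lift (h : IsSmooth φ) (i : Fin 2) (x : Fin 2 → ℝ) (t : ℝ) :
    HasDerivAt (fun t : ℝ => φ (torusMk (x + t • Pi.single i (1 : ℝ))))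
      (fderiv ℝ (fun x => φ (torusMk x)) (x + t • Pi.single i (1 : ℝ)) (Pi.single i 1)) t := by
  have h1 : HasDerivAt (fun t : ℝ => x + t • (Pi.single i (1 : ℝ) : Fin 2 → ℝ))
      (Pi.single i (1 : ℝ)) t := by
    simpa using ((hasDerivAt_id t).smul_const (Pi.single i (1 : ℝ) : Fin 2 → ℝ)).const_add x
  exact ((h.contDiff_lift.differentiable (by simp)) _).hasFDerivAt.comp_hasDerivAt t h1

lemma partialDeriv_torusMk (h : IsSmooth φ) (i : Fin 2) (x : Fin 2 → ℝ) :
    TorusNSE.partialDeriv i φ (torusMk x)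
      = fderiv ℝ (fun x => φ (torusMk x)) x (Pi.single i 1) := by
  have := (h.hasDerivAt_lift i x 0).deriv
  rw [zero_smul, add_zero] at this
  rw [← this, TorusNSE.partialDeriv]
  simp only [torusMk_add_single]

protected lemma partialDeriv (h : IsSmooth φ) (i : Fin 2) :
    IsSmooth (TorusNSE.partialDeriv i φ) := by
  change ContDiff ℝ _ (fun x => TorusNSE.partialDeriv i φ (torusMk x))
  simp only [h.partialDeriv_torusMk]
  exact (h.contDiff_lift.fderiv_right (by simp)).clm_apply contDiff_const

lemma hasDerivAt (h : IsSmooth φ) (i : Fin 2) (x : Torus) (t : ℝ) :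
    HasDerivAt (fun t : ℝ => φ (x + Pi.single i (t : AddCircle (2 * Real.pi))))
      (TorusNSE.partialDeriv i φ (x + Pi.single i (t : AddCircle (2 * Real.pi)))) t := by
  obtain ⟨y, rfl⟩ := torusMk_surjective x
  simp only [torusMk_add_single, h.partialDeriv_torusMk]
  exact h.hasDerivAt_lift i y t

lemma add {χ : Torus → ℝ} (h : IsSmooth φ) (h' : IsSmooth χ) :
    IsSmooth (fun x => φ x + χ x) := ContDiff.add h h'

protected lemma laplacian (h : IsSmooth φ) : IsSmooth (TorusNSE.laplacian φ) := by
  have : TorusNSE.laplacian φ = fun x => TorusNSE.partialDeriv 0 (TorusNSE.partialDeriv 0 φ) x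
      + TorusNSE.partialDeriv 1 (TorusNSE.partialDeriv 1 φ) x := by
    funext x; simp [TorusNSE.laplacian, Fin.sum_univ_two]
  rw [this]
  exact ((h.partialDeriv 0).partialDeriv 0).add ((h.partialDeriv 1).partialDeriv 1)

lemma exists_bound (h : IsSmooth φ) : ∃ C, ∀ x, ‖φ x‖ ≤ C := by
  obtain ⟨C, hC⟩ := isCompact_univ.exists_bound_of_continuousOn h.continuous.continuousOn
  exact ⟨C, fun x => hC x (mem_univ x)⟩

lemma integrable_ofReal (h : IsSmooth φ) : Integrable (fun x => (φ x : ℂ)) volume := by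
  have hc : Continuous (fun x => (φ x : ℂ)) := Complex.continuous_ofReal.comp h.continuous
  obtain ⟨C, hC⟩ := h.exists_bound
  exact Integrable.of_bound hc.aestronglyMeasurable C
    (Filter.Eventually.of_forall fun x => by simpa using hC x)

end IsSmooth

lemma character_single_coe (m : Freq) (i : Fin 2) (t : ℝ) :
    character m (Pi.single i (t : AddCircle (2 * Real.pi)))
      = Complex.exp (t * (Complex.I * m i)) := by
  rw [character_apply, Finset.prod_eq_single i]
  · rw [Pi.single_eq_same, fourier_coe_apply]
    congr 1
    have := two_pi_complex_ne_zero
    push_cast at this ⊢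
    field_simp
  · intro j _ hj
    rw [Pi.single_eq_of_ne hj, fourier_eval_zero]
  · simp

lemma character_add_right (m : Freq) (x y : Torus) :
    character m (x + y) = character m x * character m y := by
  simp only [character_apply, Pi.add_apply, ← Finset.prod_mul_distrib]
  refine Finset.prod_congr rfl fun i _ => ?_
  rw [fourier_apply, fourier_apply, fourier_apply, smul_add, AddCircle.toCircle_add,
    Circle.coe_mul]

/-- Differentiation multiplies the Fourier coefficients by `i m`. The reason is that a translation
by `t` in direction `i` multiplies them by `exp (i mᵢ t)`. -/
lemma coef_partialDeriv {φ : Torus → ℝ} (h : IsSmooth φ) (i : Fin 2) (m : Freq) :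
    coef (fun x => (partialDeriv i φ x : ℂ)) m
      = Complex.I * m i * coef (fun x => (φ x : ℂ)) m := by
  set F : ℝ → ℂ := fun t =>
    ∫ x, character (-m) x * (φ (x + Pi.single i (t : AddCircle (2 * Real.pi))) : ℂ) with hF
  have h1 : ∀ t, F t = Complex.exp (t * (Complex.I * m i)) * F 0 := by
    intro t
    have e1 : ∀ x : Torus, character (-m) x = Complex.exp (t * (Complex.I * m i))
        * character (-m) (x + Pi.single i (t : AddCircle (2 * Real.pi))) := by
      intro x
      have e0 : Complex.exp (t * (Complex.I * m i)) * Complex.exp (t * (Complex.I * (-m) i)) = 1 := by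
        rw [← Complex.exp_add]
        simp
      rw [character_add_right, character_single_coe]
      linear_combination -(character (-m) x) * e0
    have e2 : F t = ∫ x : Torus, (fun y => Complex.exp (t * (Complex.I * m i))
        * (character (-m) y * (φ y : ℂ))) (x + Pi.single i (t : AddCircle (2 * Real.pi))) := by
      simp only [hF]
      congr 1
      ext x
      rw [e1 x, mul_assoc]
    rw [e2, integral_add_right_eq_self (μ := (volume : Measure Torus)) (fun y =>
      Complex.exp (t * (Complex.I * m i)) * (character (-m) y * (φ y : ℂ))), integral_const_mul]
    simp [hF]
  have h2 : HasDerivAt F (Complex.I * m i * F 0) 0 := by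
    have e : HasDerivAt (fun t : ℝ => Complex.exp (t * (Complex.I * m i)) * F 0)
        (Complex.exp ((0 : ℝ) * (Complex.I * m i)) * (1 * (Complex.I * m i)) * F 0) 0 :=
      (((Complex.ofRealCLM.hasDerivAt (x := 0)).mul_const _).cexp).mul_const _
    have e' : F = fun t : ℝ => Complex.exp (t * (Complex.I * m i)) * F 0 := funext h1
    rw [e']
    convert e using 1
    simp
  have h3 : HasDerivAt F (∫ x, character (-m) x
      * (partialDeriv i φ (x + Pi.single i ((0 : ℝ) : AddCircle (2 * Real.pi))) : ℂ)) 0 := by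
    obtain ⟨C, hC⟩ := (h.partialDeriv i).exists_bound
    have hcont : ∀ {χ : Torus → ℝ}, IsSmooth χ → ∀ t : ℝ, Continuous (fun x =>
        character (-m) x * (χ (x + Pi.single i (t : AddCircle (2 * Real.pi))) : ℂ)) := by
      intro χ hχ t
      have := hχ.continuous
      fun_prop
    obtain ⟨C', hC'⟩ := h.exists_bound
    have key := hasDerivAt_integral_of_dominated_loc_of_deriv_le (𝕜 := ℝ)
      (μ := (volume : Measure Torus)) (bound := fun _ => C) (x₀ := (0 : ℝ)) (s := univ)
      (F := fun (t : ℝ) x => character (-m) x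
        * (φ (x + Pi.single i (t : AddCircle (2 * Real.pi))) : ℂ))
      (F' := fun (t : ℝ) x => character (-m) x
        * (partialDeriv i φ (x + Pi.single i (t : AddCircle (2 * Real.pi))) : ℂ))
      Filter.univ_mem
    refine (key ?_ ?_ ?_ ?_ ?_ ?_).2
    · exact Filter.Eventually.of_forall fun t => (hcont h t).aestronglyMeasurable
    · refine Integrable.of_bound (hcont h 0).aestronglyMeasurable C'
        (Filter.Eventually.of_forall fun x => ?_)
      rw [norm_mul, norm_character_apply, one_mul]
      simpa using hC' _
    · exact (hcont (h.partialDeriv i) 0).aestronglyMeasurable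
    · refine Filter.Eventually.of_forall fun x t _ => ?_
      rw [norm_mul, norm_character_apply, one_mul]
      simpa using hC _
    · exact integrable_const C
    · refine Filter.Eventually.of_forall fun x t _ => ?_
      exact ((h.hasDerivAt i x t).ofReal_comp).const_mul _
  have h4 := h3.unique h2
  simp only [hF, QuotientAddGroup.mk_zero, Pi.single_zero, add_zero] at h4
  unfold coef
  rw [h4]
  ring

/-- The symbol `|m|²` of `-Δ`. -/
noncomputable def freqSq (m : Freq) : ℝ := (m 0 : ℝ) ^ 2 + (m 1 : ℝ) ^ 2

lemma coef_laplacian {φ : Torus → ℝ} (h : IsSmooth φ) (m : Freq) :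
    coef (fun x => (laplacian φ x : ℂ)) m = -(freqSq m : ℂ) * coef (fun x => (φ x : ℂ)) m := by
  have e : coef (fun x => (laplacian φ x : ℂ)) m
      = coef (fun x => (partialDeriv 0 (partialDeriv 0 φ) x : ℂ)) m
        + coef (fun x => (partialDeriv 1 (partialDeriv 1 φ) x : ℂ)) m := by
    simp only [laplacian, Fin.sum_univ_two, coef, Complex.ofReal_add, mul_add]
    rw [integral_add
      (integrable_character_mul ((h.partialDeriv 0).partialDeriv 0).integrable_ofReal _)
      (integrable_character_mul ((h.partialDeriv 1).partialDeriv 1).integrable_ofReal _), mul_add]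
  rw [e, coef_partialDeriv (h.partialDeriv 0), coef_partialDeriv (h.partialDeriv 1),
    coef_partialDeriv h, coef_partialDeriv h, freqSq]
  push_cast
  linear_combination ((m 0 : ℂ) ^ 2 + (m 1 : ℂ) ^ 2) * coef (fun x => (φ x : ℂ)) m
    * Complex.I_mul_I

lemma norm_coef_le {f : Torus → ℂ} {C : ℝ} (hC : ∀ x, ‖f x‖ ≤ C) :
    ∃ K, ∀ m, ‖coef f m‖ ≤ K := by
  refine ⟨‖((2 * Real.pi : ℝ) : ℂ)⁻¹‖ * (C * (volume : Measure Torus).real univ), fun m => ?_⟩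
  rw [coef, norm_mul]
  gcongr
  refine norm_integral_le_of_norm_le_const (Filter.Eventually.of_forall fun x => ?_)
  rw [norm_mul, norm_character_apply, one_mul]
  exact hC x

lemma freqSq_nonneg (m : Freq) : 0 ≤ freqSq m := by unfold freqSq; positivity

lemma norm_sq_le_freqSq (m : Freq) : ‖m‖ ^ 2 ≤ freqSq m := by
  have : ‖m‖ ≤ Real.sqrt (freqSq m) := by
    rw [pi_norm_le_iff_of_nonneg (Real.sqrt_nonneg _)]
    intro i
    apply Real.le_sqrt_of_sq_le
    rw [Int.norm_eq_abs, sq_abs, freqSq]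
    fin_cases i
    · simp only [Fin.zero_eta]; nlinarith [sq_nonneg (m 1 : ℝ)]
    · simp only [Fin.mk_one]; nlinarith [sq_nonneg (m 0 : ℝ)]
  calc ‖m‖ ^ 2 ≤ Real.sqrt (freqSq m) ^ 2 := by gcongr
    _ = freqSq m := Real.sq_sqrt (freqSq_nonneg m)

lemma one_le_norm_of_ne_zero {m : Freq} (hm : m ≠ 0) : 1 ≤ ‖m‖ := by
  obtain ⟨i, hi⟩ := Function.ne_iff.mp hm
  refine le_trans ?_ (norm_le_pi_norm m i)
  rw [Int.norm_eq_abs]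
  exact_mod_cast Int.one_le_abs hi

lemma one_le_freqSq {m : Freq} (hm : m ≠ 0) : 1 ≤ freqSq m := by
  nlinarith [norm_sq_le_freqSq m, one_le_norm_of_ne_zero hm]

/-- Lattice sums `∑ |m|^{-p}` converge for `p > 2`. -/
lemma summable_freqSq_rpow {p : ℝ} (hp : 2 < p) : Summable fun m : Freq => freqSq m ^ (-(p / 2)) := by
  refine Summable.of_nonneg_of_le (fun m => Real.rpow_nonneg (freqSq_nonneg m) _) (fun m => ?_)
    (EisensteinSeries.summable_one_div_norm_rpow hp)
  rcases eq_or_ne m 0 with rfl | hm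
  · have h1 : -(p / 2) ≠ 0 := by linarith
    have h2 : -p ≠ 0 := by linarith
    simp [freqSq, Real.zero_rpow h1, Real.zero_rpow h2]
  · have h0 : 0 < ‖m‖ := lt_of_lt_of_le one_pos (one_le_norm_of_ne_zero hm)
    calc freqSq m ^ (-(p / 2)) ≤ (‖m‖ ^ 2) ^ (-(p / 2)) :=
          Real.rpow_le_rpow_of_nonpos (by positivity) (norm_sq_le_freqSq m) (by linarith)
      _ = ‖m‖ ^ (-p) := by
          rw [← Real.rpow_natCast, ← Real.rpow_mul h0.le]
          congr 1
          push_cast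
          ring

/-- The Fourier series of a smooth function converges absolutely, since its coefficients are
`O(|m|⁻⁴)`. -/
lemma IsSmooth.summable_coef {φ : Torus → ℝ} (h : IsSmooth φ) :
    Summable fun m => coef (fun x => (φ x : ℂ)) m := by
  obtain ⟨C, hC⟩ := h.laplacian.laplacian.exists_bound
  obtain ⟨K, hK⟩ := norm_coef_le (f := fun x => (laplacian (laplacian φ) x : ℂ)) (C := C)
    (fun x => by simpa using hC x)
  have hs : Summable fun m : Freq => K * freqSq m ^ (-((4 : ℝ) / 2)) :=
    (summable_freqSq_rpow (by norm_num)).mul_left K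
  refine Summable.of_norm_bounded_eventually hs ?_
  refine (Set.finite_singleton (0 : Freq)).subset fun m hm => ?_
  by_contra hne
  refine hm ?_
  have hq := one_le_freqSq (m := m) hne
  have h1 := hK m
  rw [coef_laplacian h.laplacian, coef_laplacian h, norm_mul, norm_mul, norm_neg,
    Complex.norm_real, Real.norm_of_nonneg (freqSq_nonneg m)] at h1
  have h2 : freqSq m ^ (-((4 : ℝ) / 2)) = (freqSq m ^ 2)⁻¹ := by
    rw [Real.rpow_neg (freqSq_nonneg m)]
    norm_num
  rw [Set.mem_ofPred_eq, h2, ← div_eq_mul_inv, le_div_iff₀ (by positivity)]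
  linarith

lemma integrable_ofReal_mul {h : Torus → ℝ} (hh : Integrable h volume) {φ : Torus → ℂ}
    (hφ : Continuous φ) : Integrable (fun x => φ x * (h x : ℂ)) volume := by
  obtain ⟨C, hC⟩ := isCompact_univ.exists_bound_of_continuousOn hφ.continuousOn
  exact hh.ofReal.bdd_mul hφ.aestronglyMeasurable
    (Filter.Eventually.of_forall fun x => hC x (mem_univ x))

/-- Parseval's identity for the pairing of an integrable function with a smooth one. -/
lemma IsSmooth.hasSum_coef_mul {φ : Torus → ℝ} (hφ : IsSmooth φ) {h : Torus → ℝ}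
    (hh : Integrable h volume) :
    HasSum (fun m => coef (fun x => (φ x : ℂ)) m * conj (coef (fun x => (h x : ℂ)) m))
      ((∫ x, h x * φ x : ℝ) : ℂ) := by
  set Φ : C(Torus, ℂ) := ⟨fun x => (φ x : ℂ), Complex.continuous_ofReal.comp hφ.continuous⟩ with hΦ
  have hcoef : ∀ m, coef (ContinuousMap.toLp (E := ℂ) 2 volume ℂ Φ) m
      = coef (fun x => (φ x : ℂ)) m := fun m =>
    coef_congr (ContinuousMap.coeFn_toLp (p := 2) (𝕜 := ℂ) volume Φ) m
  have hsum : HasSum (fun m => (coef (fun x => (φ x : ℂ)) m * ((2 * Real.pi : ℝ) : ℂ)⁻¹)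
      • character m) Φ := by
    refine ContinuousMap.hasSum_of_hasSum_Lp (p := 2) (𝕜 := ℂ) (μ := (volume : Measure Torus)) ?_ ?_
    · refine Summable.of_norm ?_
      have hn : ∀ m, ‖character m‖ ≤ 1 := fun m =>
        (ContinuousMap.norm_le _ zero_le_one).mpr fun x => (norm_character_apply m x).le
      refine Summable.of_nonneg_of_le (fun _ => norm_nonneg _) (fun m => ?_)
        ((hφ.summable_coef.mul_right ((2 * Real.pi : ℝ) : ℂ)⁻¹).norm)
      rw [norm_smul]
      exact mul_le_of_le_one_right (norm_nonneg _) (hn m)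
    · have := fourierBasis.hasSum_repr (ContinuousMap.toLp (E := ℂ) 2 volume ℂ Φ)
      refine this.congr_fun fun m => ?_
      rw [fourierBasis_repr, hcoef, fourierBasis, HilbertBasis.coe_mk, characterLp, smul_smul,
        Function.comp_apply, map_smul]
  obtain ⟨L, hL⟩ : ∃ L : C(Torus, ℂ) →L[ℂ] ℂ, ∀ χ, L χ = ∫ x, χ x * (h x : ℂ) := by
    refine ⟨LinearMap.mkContinuous
      { toFun := fun χ => ∫ x, χ x * (h x : ℂ)
        map_add' := fun χ ξ => ?_
        map_smul' := fun c χ => ?_ } (∫ x, ‖h x‖) fun χ => ?_, fun χ => rfl⟩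
    · rw [← integral_add (integrable_ofReal_mul hh χ.continuous)
        (integrable_ofReal_mul hh ξ.continuous)]
      simp only [ContinuousMap.add_apply, add_mul]
    · simp only [ContinuousMap.smul_apply, smul_eq_mul, mul_assoc, RingHom.id_apply]
      rw [integral_const_mul]
    · simp only [LinearMap.coe_mk, AddHom.coe_mk]
      have hle : ‖∫ x, χ x * (h x : ℂ)‖ ≤ ∫ x, ‖χ‖ * ‖h x‖ := by
        refine norm_integral_le_of_norm_le (hh.norm.const_mul _)
          (Filter.Eventually.of_forall fun x => ?_)
        rw [norm_mul, Complex.norm_real]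
        gcongr
        exact χ.norm_coe_le_norm x
      rw [integral_const_mul] at hle
      linarith
  have h1 := hsum.mapL L
  rw [hL] at h1
  convert h1 using 1
  · funext m
    rw [map_smul, hL, smul_eq_mul, mul_assoc, ← coef_ofReal_neg]
    conv_lhs => rw [coef.eq_def (fun x => (h x : ℂ)), neg_neg]
  · rw [← integral_complex_ofReal]
    congr 1
    ext x
    simp [hΦ, mul_comm]

/-! ### Testing distributions against characters -/

/-- The real trigonometric monomial `Re (c exp (i m · x))`. -/
noncomputable def trigMonomial (c : ℂ) (m : Freq) (x : Torus) : ℝ := (c * character m x).re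

lemma character_torusMk (m : Freq) (x : Fin 2 → ℝ) :
    character m (torusMk x) = Complex.exp (Complex.I * (m 0 * x 0 + m 1 * x 1)) := by
  rw [character_apply, Fin.prod_univ_two, torusMk, torusMk, fourier_coe_apply, fourier_coe_apply,
    ← Complex.exp_add]
  congr 1
  have := two_pi_complex_ne_zero
  push_cast at this ⊢
  field_simp

lemma isSmooth_trigMonomial (c : ℂ) (m : Freq) : IsSmooth (trigMonomial c m) := by
  change ContDiff ℝ _ (fun x => (c * character m (torusMk x)).re)
  simp only [character_torusMk]
  have h : ∀ i : Fin 2, ContDiff ℝ ((⊤ : ℕ∞) : WithTop ℕ∞) fun x : Fin 2 → ℝ => ((x i : ℝ) : ℂ) :=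
    fun i => Complex.ofRealCLM.contDiff.comp (contDiff_apply ℝ ℝ i)
  have h' : ContDiff ℝ ((⊤ : ℕ∞) : WithTop ℕ∞) fun x : Fin 2 → ℝ =>
      c * Complex.exp (Complex.I * (m 0 * x 0 + m 1 * x 1)) :=
    contDiff_const.mul (ContDiff.cexp (contDiff_const.mul
      ((contDiff_const.mul (h 0)).add (contDiff_const.mul (h 1)))))
  exact Complex.reCLM.contDiff.comp h'

lemma partialDeriv_trigMonomial (i : Fin 2) (c : ℂ) (m : Freq) :
    partialDeriv i (trigMonomial c m) = trigMonomial (c * (Complex.I * m i)) m := by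
  funext x
  have e : HasDerivAt (fun t : ℝ => c * (character m x * Complex.exp (t * (Complex.I * m i))))
      (c * (character m x * (Complex.exp ((0 : ℝ) * (Complex.I * m i))
        * (1 * (Complex.I * m i))))) 0 :=
    ((((Complex.ofRealCLM.hasDerivAt (x := 0)).mul_const _).cexp).const_mul _).const_mul _
  have e2 := (Complex.reCLM.hasFDerivAt.comp_hasDerivAt (0 : ℝ) e).deriv
  rw [partialDeriv]
  simp only [trigMonomial, character_add_right, character_single_coe]
  refine e2.trans ?_
  simp only [Complex.reCLM_apply]
  congr 1
  simp
  ring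

lemma laplacian_trigMonomial (c : ℂ) (m : Freq) :
    laplacian (trigMonomial c m) = trigMonomial (-(freqSq m) * c) m := by
  funext x
  simp only [laplacian, Fin.sum_univ_two, partialDeriv_trigMonomial, trigMonomial, freqSq]
  rw [← Complex.add_re]
  congr 1
  push_cast
  linear_combination ((m 0 : ℂ) ^ 2 + (m 1 : ℂ) ^ 2) * c * character m x * Complex.I_mul_I

lemma integral_mul_trigMonomial {h : Torus → ℝ} (hh : Integrable h volume) (c : ℂ) (m : Freq) :
    ∫ x, h x * trigMonomial c (-m) x
      = (c * (((2 * Real.pi : ℝ) : ℂ) * coef (fun x => (h x : ℂ)) m)).re := by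
  rw [coef, mul_inv_cancel_left₀ two_pi_complex_ne_zero, ← integral_const_mul]
  have hi : Integrable (fun x => c * (character (-m) x * (h x : ℂ))) volume :=
    (integrable_ofReal_mul hh (character (-m)).continuous).const_mul c
  have := integral_re hi
  refine Eq.trans ?_ this
  congr 1
  ext x
  simp only [trigMonomial, RCLike.re_eq_complex_re]
  rw [← mul_assoc, Complex.re_mul_ofReal, mul_comm]

/-- A distribution of order at most two with integrable coefficients vanishes if and only if its
Fourier coefficients do. -/
lemma pairing_eq_zero_iff {a d : Torus → ℝ} {b : Fin 2 → Torus → ℝ} (ha : Integrable a volume)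
    (hb : ∀ i, Integrable (b i) volume) (hd : Integrable d volume) :
    (∀ φ : Torus → ℝ, IsSmooth φ →
      (∫ x, a x * φ x) + (∑ i, ∫ x, b i x * partialDeriv i φ x) + (∫ x, d x * laplacian φ x) = 0) ↔
    ∀ m : Freq, coef (fun x => (a x : ℂ)) m - ∑ i, Complex.I * m i * coef (fun x => (b i x : ℂ)) m
      - freqSq m * coef (fun x => (d x : ℂ)) m = 0 := by
  constructor
  · intro H m
    have key : ∀ c : ℂ, (c * (((2 * Real.pi : ℝ) : ℂ) * (coef (fun x => (a x : ℂ)) m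
        - ∑ i, Complex.I * m i * coef (fun x => (b i x : ℂ)) m
        - freqSq m * coef (fun x => (d x : ℂ)) m))).re = 0 := by
      intro c
      have h := H _ (isSmooth_trigMonomial c (-m))
      simp only [partialDeriv_trigMonomial, laplacian_trigMonomial, Fin.sum_univ_two] at h
      rw [integral_mul_trigMonomial ha, integral_mul_trigMonomial (hb 0),
        integral_mul_trigMonomial (hb 1), integral_mul_trigMonomial hd, ← Complex.add_re,
        ← Complex.add_re, ← Complex.add_re] at h
      rw [← h, Fin.sum_univ_two]
      congr 1
      have hq : freqSq (-m) = freqSq m := by simp [freqSq]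
      rw [hq]
      simp only [Pi.neg_apply, Int.cast_neg]
      ring
    have hz : ∀ z : ℂ, (∀ c : ℂ, (c * z).re = 0) → z = 0 := by
      intro z hz
      have h1 := hz 1
      have h2 := hz Complex.I
      apply Complex.ext
      · simpa using h1
      · simpa using h2
    have := hz _ key
    exact (mul_eq_zero.mp this).resolve_left two_pi_complex_ne_zero
  · intro H φ hφ
    have h1 := hφ.hasSum_coef_mul ha
    have h2 := (hφ.partialDeriv 0).hasSum_coef_mul (hb 0)
    have h3 := (hφ.partialDeriv 1).hasSum_coef_mul (hb 1)
    have h4 := hφ.laplacian.hasSum_coef_mul hd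
    have h5 := ((h1.add (h2.add h3)).add h4).congr_fun (g := fun _ => 0) (fun m => by
      rw [coef_partialDeriv hφ, coef_partialDeriv hφ, coef_laplacian hφ]
      have := congrArg (fun z => coef (fun x => (φ x : ℂ)) m * conj z) (H m)
      simp only [Fin.sum_univ_two, map_sub, map_add, map_mul, Complex.conj_I, Complex.conj_ofReal,
        map_intCast, map_zero, mul_zero] at this
      rw [← this]
      ring)
    have h6 := h5.unique hasSum_zero
    rw [Fin.sum_univ_two]
    exact_mod_cast h6


/-! ### The scheme in Fourier variables -/

lemma integrable_L2 (u : L2) : Integrable (fun x => u x) (volume : Measure Torus) :=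
  (Lp.memLp u).integrable one_le_two

lemma integrable_L2_mul (u v : L2) : Integrable (fun x => u x * v x) (volume : Measure Torus) :=
  (Lp.memLp u).integrable_mul (Lp.memLp v)

lemma integrable_mul_isSmooth {h φ : Torus → ℝ} (hh : Integrable h volume) (hφ : IsSmooth φ) :
    Integrable (fun x => h x * φ x) volume := by
  obtain ⟨C, hC⟩ := hφ.exists_bound
  exact hh.mul_bdd hφ.continuous.aestronglyMeasurable (Filter.Eventually.of_forall hC)

lemma isStreamfunction_iff (ω ψ : L2dot) :
    IsStreamfunction ω ψ ↔ ∀ m, (freqSq m : ℂ) * hat ψ m = hat ω m := by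
  have h := pairing_eq_zero_iff (a := fun x => (ω : L2) x) (d := fun x => (ψ : L2) x)
    (b := fun _ _ => 0) (integrable_L2 _) (fun _ => integrable_zero _ _ _) (integrable_L2 _)
  simp only [zero_mul, integral_zero, Finset.sum_const_zero, add_zero] at h
  have hz : ∀ m, coef (fun _ => ((0 : ℝ) : ℂ)) m = 0 := fun m => by simp [coef]
  simp only [hz, mul_zero, Finset.sum_const_zero, sub_zero] at h
  constructor
  · intro H m
    have := h.mp (fun φ hφ => by linarith [H φ hφ]) m
    exact (sub_eq_zero.mp this).symm
  · intro H φ hφ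
    have := h.mpr (fun m => sub_eq_zero.mpr (H m).symm) φ hφ
    linarith

lemma isWeakGradient_iff (u : L2) (D : Fin 2 → L2) :
    IsWeakGradient u D ↔ ∀ i m, hat (D i) m = Complex.I * m i * hat u m := by
  have hz : ∀ m, coef (fun _ => ((0 : ℝ) : ℂ)) m = 0 := fun m => by simp [coef]
  have hz' : ∀ m, coef (fun _ => 0) m = 0 := fun m => by simp [coef]
  refine forall_congr' fun i => ?_
  have h := pairing_eq_zero_iff (a := fun x => (D i) x) (d := fun _ => 0)
    (b := fun j x => if j = i then u x else 0) (integrable_L2 _)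
    (fun j => by
      by_cases hj : j = i
      · simpa only [hj, if_true] using integrable_L2 u
      · simp only [hj, if_false]; exact integrable_zero _ _ _)
    (integrable_zero _ _ _)
  have h1 : ∀ φ : Torus → ℝ, ∑ j, ∫ x, (if j = i then u x else 0) * partialDeriv j φ x
      = ∫ x, u x * partialDeriv i φ x := by
    intro φ
    rw [Finset.sum_eq_single i]
    · simp only [if_true]
    · intro j _ hj
      simp [hj]
    · simp
  have h2 : ∀ m : Freq, ∑ j, Complex.I * m j
        * coef (fun x => (((if j = i then u x else 0) : ℝ) : ℂ)) m
      = Complex.I * m i * hat u m := by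
    intro m
    rw [Finset.sum_eq_single i]
    · simp only [if_true]; rfl
    · intro j _ hj
      simp [hj, hz' m]
    · simp
  simp only [h1, h2, hz, zero_mul, integral_zero, add_zero, mul_zero, sub_zero] at h
  constructor
  · intro H m
    exact sub_eq_zero.mp (h.mp (fun φ hφ => by linarith [H φ hφ]) m)
  · intro H φ hφ
    have := h.mpr (fun m => sub_eq_zero.mpr (H m)) φ hφ
    linarith

/-- The nonlinearity in Fourier variables: if `a` and `b` are the coefficients of `α` and `β`, this
gives those of `∇^⊥(-Δ)⁻¹α · ∇β`. The factor in front comes from the normalization of `coef`. -/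
noncomputable def advection (a b : Freq → ℂ) (m : Freq) : ℂ :=
  ((2 * Real.pi : ℝ) : ℂ)⁻¹ * ∑' j, (((m 0 * j 1 - m 1 * j 0 : ℝ) / freqSq j : ℝ) : ℂ) * a j * b (m - j)

lemma freqSq_eq_zero_iff {m : Freq} : freqSq m = 0 ↔ m = 0 := by
  constructor
  · intro h
    by_contra hm
    linarith [one_le_freqSq hm]
  · rintro rfl
    simp [freqSq]

@[simp] lemma freqSq_neg (m : Freq) : freqSq (-m) = freqSq m := by simp [freqSq]

lemma abs_le_freqSq (m : Freq) (i : Fin 2) : |(m i : ℝ)| ≤ freqSq m := by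
  have h : ∀ n : ℤ, |(n : ℝ)| ≤ (n : ℝ) ^ 2 := fun n => by
    rw [← sq_abs]
    have : |n| ≤ |n| ^ 2 := by
      rcases eq_or_ne n 0 with rfl | hn
      · simp
      · nlinarith [Int.one_le_abs hn]
    exact_mod_cast this
  refine (h _).trans ?_
  unfold freqSq
  fin_cases i
  · simp only [Fin.zero_eta]; nlinarith [sq_nonneg (m 1 : ℝ)]
  · simp only [Fin.mk_one]; nlinarith [sq_nonneg (m 0 : ℝ)]

lemma hat_coe_zero (ω : L2dot) : hat ω 0 = 0 := (mem_meanZero_iff _).mp ω.2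

/-- Riesz–Fischer for mean-zero functions. -/
lemma exists_L2dot_hat_eq {a : Freq → ℂ} (ha : Summable fun m => ‖a m‖ ^ 2)
    (hsymm : ∀ m, a (-m) = conj (a m)) (h0 : a 0 = 0) : ∃ u : L2dot, hat u = a := by
  obtain ⟨u, hu⟩ := exists_hat_eq ha hsymm
  exact ⟨⟨u, (mem_meanZero_iff u).mpr (by rw [hu, h0])⟩, hu⟩

lemma exists_streamfunction (ω : L2dot) :
    ∃ (ψ : L2dot) (D : Fin 2 → L2), IsStreamfunction ω ψ ∧ IsWeakGradient ψ D := by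
  have hs := (hasSum_norm_hat_sq (ω : L2)).summable
  have hψ : ∃ ψ : L2dot, hat ψ = fun m => (freqSq m : ℂ)⁻¹ * hat ω m := by
    refine exists_L2dot_hat_eq (hs.of_nonneg_of_le (fun _ => by positivity) fun m => ?_)
      (fun m => ?_) (by simp [hat_coe_zero])
    · rw [norm_mul, norm_inv, Complex.norm_real, Real.norm_of_nonneg (freqSq_nonneg m)]
      rcases eq_or_ne m 0 with rfl | hm
      · simp [hat_coe_zero]
      · refine pow_le_pow_left₀ (mul_nonneg (inv_nonneg.mpr (freqSq_nonneg m)) (norm_nonneg _)) ?_ 2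
        exact mul_le_of_le_one_left (norm_nonneg (hat ω m)) (inv_le_one_of_one_le₀ (one_le_freqSq hm))
    · rw [freqSq_neg, hat_neg, map_mul, map_inv₀, Complex.conj_ofReal]
  obtain ⟨ψ, hψ⟩ := hψ
  have hq : ∀ m, (freqSq m : ℂ) * hat ψ m = hat ω m := by
    intro m
    rw [hψ]
    rcases eq_or_ne m 0 with rfl | hm
    · simp [hat_coe_zero]
    · have : (freqSq m : ℂ) ≠ 0 := by
        rw [Complex.ofReal_ne_zero, Ne, freqSq_eq_zero_iff]; exact hm
      field_simp
  have hD : ∀ i : Fin 2, ∃ Di : L2, hat Di = fun m : Freq => Complex.I * m i * hat ψ m := by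
    intro i
    refine exists_hat_eq (hs.of_nonneg_of_le (fun _ => by positivity) fun m => ?_) fun m => ?_
    · rw [← hq m]
      simp only [norm_mul, Complex.norm_I, one_mul, Complex.norm_real,
        Real.norm_of_nonneg (freqSq_nonneg m)]
      gcongr
      simpa using abs_le_freqSq m i
    · rw [hat_neg, map_mul, map_mul, Complex.conj_I, map_intCast, Pi.neg_apply, Int.cast_neg]
      ring
  choose D hD using hD
  exact ⟨ψ, D, (isStreamfunction_iff ω ψ).mpr hq,
    (isWeakGradient_iff ψ D).mpr fun i m => by rw [hD i]⟩

/-- The transport term of the scheme, in Fourier variables. -/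
lemma coef_transport {ω ψ : L2dot} {D : Fin 2 → L2} (hψ : IsStreamfunction ω ψ)
    (hD : IsWeakGradient ψ D) (m : Freq) :
    Complex.I * m 1 * coef (fun x => (((ω : L2) x * D 0 x : ℝ) : ℂ)) m
      - Complex.I * m 0 * coef (fun x => (((ω : L2) x * D 1 x : ℝ) : ℂ)) m
    = advection (hat ω) (hat ω) m := by
  rw [isStreamfunction_iff] at hψ
  rw [isWeakGradient_iff] at hD
  have h0 := (hasSum_coef_mul (ω : L2) (D 0) m).mul_left (Complex.I * m 1)
  have h1 := (hasSum_coef_mul (ω : L2) (D 1) m).mul_left (Complex.I * m 0)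
  have h2 := h0.sub h1
  have h3 :=
    (h2.congr_fun (g := fun j => (((m 0 * j 1 - m 1 * j 0 : ℝ) / freqSq j : ℝ) : ℂ)
      * hat ω j * hat ω (m - j)) fun j => by
        rw [hD, hD, ← hψ j]
        rcases eq_or_ne j 0 with rfl | hj
        · simp
        · have : (freqSq j : ℂ) ≠ 0 := by
            rw [Complex.ofReal_ne_zero, Ne, freqSq_eq_zero_iff]; exact hj
          push_cast
          field_simp
          linear_combination (m 0 * j 1 - m 1 * j 0 : ℂ) * hat ψ j * hat ω (m - j) * Complex.I_sq).tsum_eq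
  rw [advection, h3]
  have := two_pi_complex_ne_zero
  field_simp

lemma isSchemeStep_iff (ν k : ℝ) (g ω ω' : L2dot) :
    IsSchemeStep ν k g ω ω' ↔ ∀ m, (hat ω' m - hat ω m) / k
      + advection (hat ω) (hat ω) m + ν * freqSq m * hat ω' m
        = hat g m := by
  have key : ∀ (ψ : L2dot) (D : Fin 2 → L2), IsStreamfunction ω ψ → IsWeakGradient ψ D →
      ((∀ φ : Torus → ℝ, IsSmooth φ →
        (∫ x, (((ω' : L2) x - (ω : L2) x) / k) * φ x)
          - (∫ x, (ω : L2) x * (-(D 1 x) * partialDeriv 0 φ x + D 0 x * partialDeriv 1 φ x))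
          - ν * (∫ x, (ω' : L2) x * laplacian φ x)
        = ∫ x, (g : L2) x * φ x) ↔ ∀ m, (hat ω' m - hat ω m) / k
      + advection (hat ω) (hat ω) m + ν * freqSq m * hat ω' m
        = hat g m) := by
    intro ψ D hψ hD
    have ia : Integrable (fun x => ((ω' : L2) x - (ω : L2) x) / k) (volume : Measure Torus) :=
      ((integrable_L2 _).sub (integrable_L2 _)).div_const k
    have h := pairing_eq_zero_iff
      (a := fun x => ((ω' : L2) x - (ω : L2) x) / k - (g : L2) x)
      (b := ![fun x => (ω : L2) x * D 1 x, fun x => -((ω : L2) x * D 0 x)])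
      (d := fun x => -ν * (ω' : L2) x)
      (ia.sub (integrable_L2 _))
      (fun i => by
        fin_cases i
        · exact integrable_L2_mul _ _
        · exact (integrable_L2_mul _ _).neg)
      ((integrable_L2 _).const_mul _)
    simp only [Fin.sum_univ_two, Matrix.cons_val_zero, Matrix.cons_val_one] at h
    have e1 : ∀ φ : Torus → ℝ, IsSmooth φ →
        (∫ x, (((ω' : L2) x - (ω : L2) x) / k - (g : L2) x) * φ x) =
        (∫ x, (((ω' : L2) x - (ω : L2) x) / k) * φ x) - ∫ x, (g : L2) x * φ x := by
      intro φ hφ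
      rw [← integral_sub (integrable_mul_isSmooth ia hφ)
        (integrable_mul_isSmooth (integrable_L2 _) hφ)]
      simp only [sub_mul]
    have e2 : ∀ φ : Torus → ℝ, IsSmooth φ →
        (∫ x, (ω : L2) x * (-(D 1 x) * partialDeriv 0 φ x + D 0 x * partialDeriv 1 φ x))
        = -((∫ x, (ω : L2) x * D 1 x * partialDeriv 0 φ x)
          + ∫ x, -((ω : L2) x * D 0 x) * partialDeriv 1 φ x) := by
      intro φ hφ
      have j1 := integrable_mul_isSmooth (integrable_L2_mul ω (D 1)) (hφ.partialDeriv 0)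
      have j2 : Integrable (fun x => -((ω : L2) x * D 0 x) * partialDeriv 1 φ x) volume :=
        integrable_mul_isSmooth (integrable_L2_mul ω (D 0)).neg (hφ.partialDeriv 1)
      rw [← integral_add j1 j2, ← integral_neg]
      congr 1
      ext x
      ring
    have e3 : ∀ φ : Torus → ℝ, (∫ x, -ν * (ω' : L2) x * laplacian φ x)
        = -(ν * ∫ x, (ω' : L2) x * laplacian φ x) := by
      intro φ
      rw [← neg_mul, ← integral_const_mul]
      simp only [mul_assoc]
    have c1 : ∀ m, coef (fun x => ((((ω' : L2) x - (ω : L2) x) / k - (g : L2) x : ℝ) : ℂ)) m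
        = (hat ω' m - hat ω m) / k - hat g m := by
      intro m
      have i1 := integrable_character_mul (integrable_ofReal (ω' : L2)) (-m)
      have i2 := integrable_character_mul (integrable_ofReal (ω : L2)) (-m)
      have i3 := integrable_character_mul (integrable_ofReal (g : L2)) (-m)
      simp only [hat, coef]
      rw [← mul_sub, mul_div_assoc, ← mul_sub]
      congr 1
      have i4 : Integrable (fun x => (character (-m) x * (((ω' : L2) x : ℝ) : ℂ)
          - character (-m) x * (((ω : L2) x : ℝ) : ℂ)) / (k : ℂ)) volume :=
        (i1.sub i2).div_const _
      rw [← integral_sub i1 i2, ← integral_div, ← integral_sub i4 i3]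
      congr 1
      ext x
      push_cast
      ring
    have c2 : ∀ m, coef (fun x => ((-((ω : L2) x * D 0 x) : ℝ) : ℂ)) m
        = -coef (fun x => (((ω : L2) x * D 0 x : ℝ) : ℂ)) m := by
      intro m
      simp only [coef, Complex.ofReal_neg, mul_neg, integral_neg]
    have c3 : ∀ m, coef (fun x => ((-ν * (ω' : L2) x : ℝ) : ℂ)) m = -ν * hat ω' m := by
      intro m
      simp only [hat, coef, Complex.ofReal_neg, Complex.ofReal_mul, mul_left_comm _ (-(ν : ℂ))]
      rw [integral_const_mul]
      ring
    have ht := coef_transport hψ hD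
    refine Iff.trans (Iff.trans ?_ h) ?_
    · refine forall_congr' fun φ => forall_congr' fun hφ => ?_
      rw [e1 φ hφ, e2 φ hφ, e3 φ, ← sub_eq_zero]
      refine Eq.congr_left ?_
      ring
    · refine forall_congr' fun m => ?_
      rw [c1, c2, c3, ← ht, ← sub_eq_zero (b := hat g m)]
      refine Eq.congr_left ?_
      ring
  constructor
  · rintro ⟨ψ, D, hψ, hD, h⟩
    exact (key ψ D hψ hD).mp h
  · intro h
    obtain ⟨ψ, D, hψ, hD⟩ := exists_streamfunction ω
    exact ⟨ψ, D, hψ, hD, (key ψ D hψ hD).mpr h⟩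

/-- A bound of the Sobolev norm from the decay of the Fourier coefficients. -/
lemma h1NormLE_of_summable {u : L2} (hs : Summable fun m => freqSq m * ‖hat u m‖ ^ 2) {M : ℝ}
    (hM : 0 ≤ M) (h : ‖u‖ ^ 2 + ∑' m, freqSq m * ‖hat u m‖ ^ 2 ≤ M ^ 2) : H1NormLE u M := by
  have hle : ∀ (i : Fin 2) (m : Freq),
      ‖Complex.I * m i * hat u m‖ ^ 2 = (m i : ℝ) ^ 2 * ‖hat u m‖ ^ 2 := by
    intro i m
    rw [norm_mul, norm_mul, Complex.norm_I, one_mul, mul_pow, Complex.norm_intCast, sq_abs]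
  have hsi : ∀ i : Fin 2, Summable fun m : Freq => ‖Complex.I * m i * hat u m‖ ^ 2 := by
    intro i
    refine hs.of_nonneg_of_le (fun _ => by positivity) fun m => ?_
    rw [hle]
    gcongr
    unfold freqSq
    fin_cases i
    · simp only [Fin.zero_eta]; nlinarith [sq_nonneg (m 1 : ℝ)]
    · simp only [Fin.mk_one]; nlinarith [sq_nonneg (m 0 : ℝ)]
  have hD : ∀ i : Fin 2, ∃ Di : L2, hat Di = fun m : Freq => Complex.I * m i * hat u m := by
    intro i
    refine exists_hat_eq (hsi i) fun m => ?_
    rw [hat_neg, map_mul, map_mul, Complex.conj_I, map_intCast, Pi.neg_apply, Int.cast_neg]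
    ring
  choose D hD using hD
  refine ⟨D, (isWeakGradient_iff u D).mpr fun i m => by rw [hD i], Real.sqrt_le_iff.mpr ⟨hM, ?_⟩⟩
  have hn : ∀ i, HasSum (fun m : Freq => (m i : ℝ) ^ 2 * ‖hat u m‖ ^ 2) (‖D i‖ ^ 2) := by
    intro i
    have := hasSum_norm_hat_sq (D i)
    rw [hD i] at this
    simpa only [hle] using this
  have := ((hn 0).add (hn 1)).tsum_eq
  simp only [← add_mul] at this
  rw [Fin.sum_univ_two, ← this]
  exact h


/-! ### Lattice sums and convolution estimates -/

/-- The Cauchy–Schwarz inequality for sums of extended nonnegative reals. -/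
lemma sq_tsum_le_tsum_mul_tsum {ι : Type*} {f g h : ι → ℝ≥0∞} (H : ∀ i, h i ^ 2 ≤ f i * g i) :
    (∑' i, h i) ^ 2 ≤ (∑' i, f i) * ∑' i, g i := by
  have hsq : ∀ x : ℝ≥0∞, (x ^ (1 / 2 : ℝ)) ^ (2 : ℝ) = x := fun x => by
    rw [← ENNReal.rpow_mul]; norm_num
  have hle : ∑' i, h i ≤ (∑' i, f i) ^ (1 / 2 : ℝ) * (∑' i, g i) ^ (1 / 2 : ℝ) := by
    rw [ENNReal.tsum_eq_iSup_sum]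
    refine iSup_le fun s => ?_
    have h1 : ∀ i, h i ≤ f i ^ (1 / 2 : ℝ) * g i ^ (1 / 2 : ℝ) := fun i => by
      rw [← ENNReal.mul_rpow_of_nonneg _ _ (by norm_num)]
      have := ENNReal.rpow_le_rpow (H i) (by norm_num : (0 : ℝ) ≤ 1 / 2)
      rwa [← ENNReal.rpow_natCast, ← ENNReal.rpow_mul, Nat.cast_ofNat,
        mul_one_div_cancel two_ne_zero, ENNReal.rpow_one] at this
    refine (Finset.sum_le_sum fun i _ => h1 i).trans ?_
    refine (ENNReal.inner_le_Lp_mul_Lq s _ _ Real.HolderConjugate.two_two).trans ?_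
    simp only [hsq]
    gcongr <;> exact ENNReal.sum_le_tsum s
  calc (∑' i, h i) ^ 2 ≤ ((∑' i, f i) ^ (1 / 2 : ℝ) * (∑' i, g i) ^ (1 / 2 : ℝ)) ^ 2 := by gcongr
    _ = (∑' i, f i) * ∑' i, g i := by
      rw [mul_pow, ← ENNReal.rpow_natCast, ← ENNReal.rpow_natCast, Nat.cast_ofNat, hsq, hsq]

/-- The Euclidean length `|m|` of a wave vector. -/
noncomputable def freqNorm (m : Freq) : ℝ := Real.sqrt (freqSq m)

lemma freqNorm_nonneg (m : Freq) : 0 ≤ freqNorm m := Real.sqrt_nonneg _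

lemma freqNorm_sq (m : Freq) : freqNorm m ^ 2 = freqSq m := Real.sq_sqrt (freqSq_nonneg m)

@[simp] lemma freqNorm_zero : freqNorm 0 = 0 := by simp [freqNorm, freqSq]

lemma one_le_freqNorm {m : Freq} (hm : m ≠ 0) : 1 ≤ freqNorm m :=
  Real.one_le_sqrt.mpr (one_le_freqSq hm)

lemma freqNorm_pos {m : Freq} (hm : m ≠ 0) : 0 < freqNorm m :=
  one_pos.trans_le (one_le_freqNorm hm)

/-- The inverse length `|m|⁻¹`, with value `0` at `m = 0`, as an extended nonnegative real. -/
noncomputable def invNorm (m : Freq) : ℝ≥0∞ := ENNReal.ofReal (freqNorm m)⁻¹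

@[simp] lemma invNorm_zero : invNorm 0 = 0 := by simp [invNorm]

/-- The value of the lattice sum `∑ |m|⁻³`. -/
noncomputable def latticeSum : ℝ := ∑' m : Freq, (freqNorm m)⁻¹ ^ 3

lemma latticeSum_nonneg : 0 ≤ latticeSum :=
  tsum_nonneg fun m => pow_nonneg (inv_nonneg.mpr (freqNorm_nonneg m)) 3

lemma tsum_invNorm_cube : ∑' m, invNorm m ^ 3 = ENNReal.ofReal latticeSum := by
  have hs : Summable fun m : Freq => (freqNorm m)⁻¹ ^ 3 := by
    refine (summable_freqSq_rpow (p := 3) (by norm_num)).congr fun m => ?_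
    rw [Real.rpow_neg (freqSq_nonneg m), Real.rpow_div_two_eq_sqrt _ (freqSq_nonneg m), inv_pow]
    norm_cast
  rw [latticeSum, ENNReal.ofReal_tsum_of_nonneg
    (fun m => pow_nonneg (inv_nonneg.mpr (freqNorm_nonneg m)) 3) hs]
  refine tsum_congr fun m => ?_
  rw [invNorm, ENNReal.ofReal_pow (inv_nonneg.mpr (freqNorm_nonneg m))]

/-- The convolution of `|m|⁻¹ f` with `g`; it dominates the Fourier coefficients of the product of
`g` with the velocity field of vorticity `f`. -/
noncomputable def velConv (f g : Freq → ℝ≥0∞) (m : Freq) : ℝ≥0∞ :=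
  ∑' j, invNorm j * f j * g (m - j)

lemma tsum_tsum_mul_shift (w s G : Freq → ℝ≥0∞) :
    ∑' m, w m * ∑' j, s j * G (m - j) = ∑' l, G l * ∑' m, w m * s (m - l) := by
  simp_rw [← ENNReal.tsum_mul_left]
  rw [ENNReal.tsum_comm (f := fun l m => G l * (w m * s (m - l)))]
  refine tsum_congr fun m => ?_
  rw [← (Equiv.subLeft m).tsum_eq (fun l => G l * (w m * s (m - l)))]
  refine tsum_congr fun j => ?_
  simp only [Equiv.subLeft_apply, sub_sub_cancel]
  ring

/-- The product of the velocity with an `L²` function is in `H^{-1/2}`. After the Cauchy–Schwarz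
inequality in the convolution, what is left is `∑ |m|⁻¹ |m - l|⁻² ≤ 2 ∑ |m|⁻³`. -/
lemma tsum_invNorm_mul_velConv_sq_le (f g : Freq → ℝ≥0∞) :
    ∑' m, invNorm m * velConv f g m ^ 2
      ≤ 2 * ENNReal.ofReal latticeSum * (∑' m, f m ^ 2) * ∑' m, g m ^ 2 := by
  have h1 : ∀ m, velConv f g m ^ 2
      ≤ (∑' j, f j ^ 2) * ∑' j, invNorm j ^ 2 * g (m - j) ^ 2 := fun m =>
    sq_tsum_le_tsum_mul_tsum fun j => le_of_eq (by ring)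
  have h2 : ∀ l, ∑' m, invNorm m * invNorm (m - l) ^ 2 ≤ 2 * ENNReal.ofReal latticeSum := by
    intro l
    calc ∑' m, invNorm m * invNorm (m - l) ^ 2
        ≤ ∑' m, (invNorm m ^ 3 + invNorm (m - l) ^ 3) := by
          refine ENNReal.tsum_le_tsum fun m => ?_
          rcases le_total (invNorm m) (invNorm (m - l)) with h | h
          · calc invNorm m * invNorm (m - l) ^ 2 ≤ invNorm (m - l) * invNorm (m - l) ^ 2 := by
                  gcongr
              _ = invNorm (m - l) ^ 3 := by ring
              _ ≤ _ := le_add_self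
          · calc invNorm m * invNorm (m - l) ^ 2 ≤ invNorm m * invNorm m ^ 2 := by gcongr
              _ = invNorm m ^ 3 := by ring
              _ ≤ _ := le_self_add
      _ = 2 * ENNReal.ofReal latticeSum := by
          have h3 : ∑' m, invNorm (m - l) ^ 3 = ∑' m, invNorm m ^ 3 :=
            (Equiv.subRight l).tsum_eq (fun m => invNorm m ^ 3)
          rw [ENNReal.tsum_add, h3, tsum_invNorm_cube, two_mul]
  calc ∑' m, invNorm m * velConv f g m ^ 2
      ≤ ∑' m, (∑' j, f j ^ 2) * (invNorm m * ∑' j, invNorm j ^ 2 * g (m - j) ^ 2) := by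
        refine ENNReal.tsum_le_tsum fun m => ?_
        rw [mul_left_comm]
        gcongr
        exact h1 m
    _ = (∑' j, f j ^ 2) * ∑' l, g l ^ 2 * ∑' m, invNorm m * invNorm (m - l) ^ 2 := by
        rw [ENNReal.tsum_mul_left, tsum_tsum_mul_shift invNorm (fun j => invNorm j ^ 2)
          (fun l => g l ^ 2)]
    _ ≤ (∑' j, f j ^ 2) * ∑' l, g l ^ 2 * (2 * ENNReal.ofReal latticeSum) := by
        gcongr
        exact h2 _
    _ = 2 * ENNReal.ofReal latticeSum * (∑' m, f m ^ 2) * ∑' m, g m ^ 2 := by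
        rw [ENNReal.tsum_mul_right]
        ring

/-- Young's inequality `ℓ¹ * ℓ² ⊆ ℓ²`. -/
lemma tsum_velConv_sq_le (f g : Freq → ℝ≥0∞) :
    ∑' m, velConv f g m ^ 2 ≤ (∑' m, invNorm m * f m) ^ 2 * ∑' m, g m ^ 2 := by
  have h1 : ∀ m, velConv f g m ^ 2
      ≤ (∑' j, invNorm j * f j) * ∑' j, invNorm j * f j * g (m - j) ^ 2 := fun m =>
    sq_tsum_le_tsum_mul_tsum fun j => le_of_eq (by ring)
  calc ∑' m, velConv f g m ^ 2
      ≤ ∑' m, (∑' j, invNorm j * f j) * (1 * ∑' j, invNorm j * f j * g (m - j) ^ 2) := by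
        refine ENNReal.tsum_le_tsum fun m => ?_
        rw [one_mul]
        exact h1 m
    _ = (∑' j, invNorm j * f j) * ∑' l, g l ^ 2 * ∑' m, 1 * (invNorm (m - l) * f (m - l)) := by
        rw [ENNReal.tsum_mul_left, tsum_tsum_mul_shift (fun _ => 1) (fun j => invNorm j * f j)
          (fun l => g l ^ 2)]
    _ = (∑' m, invNorm m * f m) ^ 2 * ∑' m, g m ^ 2 := by
        have : ∀ l, ∑' m, 1 * (invNorm (m - l) * f (m - l)) = ∑' m, invNorm m * f m := by
          intro l
          simp only [one_mul]
          exact (Equiv.subRight l).tsum_eq (fun m => invNorm m * f m)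
        simp only [this]
        rw [ENNReal.tsum_mul_right]
        ring

/-! ### Norms of sequences of Fourier coefficients -/

/-- The squared `L²` norm in Fourier variables. -/
noncomputable def normSq (a : Freq → ℂ) : ℝ≥0∞ := ∑' m, ‖a m‖ₑ ^ 2

/-- The squared `L²` norm of the gradient in Fourier variables. -/
noncomputable def gradSq (a : Freq → ℂ) : ℝ≥0∞ := ∑' m, ENNReal.ofReal (freqSq m) * ‖a m‖ₑ ^ 2

/-- The absolute sum of the Fourier coefficients of the velocity field of vorticity `a`. -/
noncomputable def velSum (a : Freq → ℂ) : ℝ≥0∞ := ∑' m, invNorm m * ‖a m‖ₑ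

lemma enorm_sq_eq_ofReal (z : ℂ) : ‖z‖ₑ ^ 2 = ENNReal.ofReal (‖z‖ ^ 2) := by
  rw [ENNReal.ofReal_pow (norm_nonneg z), ofReal_norm]

lemma normSq_le_gradSq {a : Freq → ℂ} (h0 : a 0 = 0) : normSq a ≤ gradSq a := by
  refine ENNReal.tsum_le_tsum fun m => ?_
  rcases eq_or_ne m 0 with rfl | hm
  · simp [h0]
  · exact le_mul_of_one_le_left' (by simpa using one_le_freqSq hm)

/-- A substitute for the triangle inequality that avoids square roots of sums. -/
lemma norm_add_three_sq_le {x y z : ℂ} : ‖x + y + z‖ ^ 2 ≤ 3 * (‖x‖ ^ 2 + ‖y‖ ^ 2 + ‖z‖ ^ 2) := by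
  have h := norm_add₃_le (a := x) (b := y) (c := z)
  have h0 := norm_nonneg (x + y + z)
  nlinarith [sq_nonneg (‖x‖ - ‖y‖), sq_nonneg (‖y‖ - ‖z‖), sq_nonneg (‖x‖ - ‖z‖)]

lemma velSum_sq_le_gradSq (a : Freq → ℂ) :
    velSum a ^ 2 ≤ ENNReal.ofReal latticeSum * gradSq a := by
  rw [← tsum_invNorm_cube]
  refine sq_tsum_le_tsum_mul_tsum fun m => ?_
  rw [mul_pow, ← mul_assoc]
  gcongr
  rw [invNorm, ← ENNReal.ofReal_pow (inv_nonneg.mpr (freqNorm_nonneg m)),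
    ← ENNReal.ofReal_pow (inv_nonneg.mpr (freqNorm_nonneg m)),
    ← ENNReal.ofReal_mul (pow_nonneg (inv_nonneg.mpr (freqNorm_nonneg m)) 3), ← freqNorm_sq]
  apply ENNReal.ofReal_le_ofReal
  rcases eq_or_ne m 0 with rfl | hm
  · simp
  · have h := freqNorm_pos hm
    have h1 := one_le_freqNorm hm
    have : (freqNorm m)⁻¹ ^ 3 * freqNorm m ^ 2 = (freqNorm m)⁻¹ := by field_simp
    rw [this]
    exact pow_le_of_le_one (inv_nonneg.mpr h.le) (inv_le_one_of_one_le₀ h1) two_ne_zero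

/-- The kernel `m × j = m₀ j₁ - m₁ j₀` of the advection term. -/
def cross (m j : Freq) : ℝ := m 0 * j 1 - m 1 * j 0

lemma abs_cross_le (m j : Freq) : |cross m j| ≤ freqNorm m * freqNorm j := by
  rw [freqNorm, freqNorm, ← Real.sqrt_mul (freqSq_nonneg m)]
  apply Real.abs_le_sqrt
  unfold cross freqSq
  nlinarith [sq_nonneg ((m 0 : ℝ) * j 0 + m 1 * j 1)]

lemma cross_sub_left (m j : Freq) : cross (m - j) j = cross m j := by
  simp only [cross, Pi.sub_apply, Int.cast_sub]
  ring

lemma cross_neg_right (m j : Freq) : cross m (-j) = -cross m j := by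
  simp only [cross, Pi.neg_apply, Int.cast_neg]
  ring

lemma abs_cross_div_le (m j : Freq) : |cross m j / freqSq j| ≤ freqNorm m * (freqNorm j)⁻¹ := by
  rcases eq_or_ne j 0 with rfl | hj
  · simp [cross]
  · have h := freqNorm_pos hj
    rw [abs_div, ← freqNorm_sq, abs_of_pos (pow_pos h 2), div_le_iff₀ (pow_pos h 2)]
    calc |cross m j| ≤ freqNorm m * freqNorm j := abs_cross_le m j
      _ = _ := by field_simp

/-- The terms of the series that defines `advection`. -/
noncomputable def advectionTerm (a b : Freq → ℂ) (m j : Freq) : ℂ :=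
  ((cross m j / freqSq j : ℝ) : ℂ) * a j * b (m - j)

lemma advection_eq (a b : Freq → ℂ) (m : Freq) :
    advection a b m = ((2 * Real.pi : ℝ) : ℂ)⁻¹ * ∑' j, advectionTerm a b m j := rfl

lemma enorm_ofReal_le {x y : ℝ} (h : |x| ≤ y) : ‖(x : ℂ)‖ₑ ≤ ENNReal.ofReal y := by
  rw [← ofReal_norm, Complex.norm_real, Real.norm_eq_abs]
  exact ENNReal.ofReal_le_ofReal h

lemma enorm_advectionTerm_le (a b : Freq → ℂ) (m j : Freq) :
    ‖advectionTerm a b m j‖ₑ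
      ≤ ENNReal.ofReal (freqNorm m) * (invNorm j * ‖a j‖ₑ * ‖b (m - j)‖ₑ) := by
  rw [advectionTerm, enorm_mul, enorm_mul, invNorm, ← mul_assoc, ← mul_assoc,
    ← ENNReal.ofReal_mul (freqNorm_nonneg m)]
  gcongr
  exact enorm_ofReal_le (abs_cross_div_le m j)

/-- As the velocity is divergence free, the derivative may also be put on the advected function. -/
lemma enorm_advectionTerm_le' (a b : Freq → ℂ) (m j : Freq) :
    ‖advectionTerm a b m j‖ₑ
      ≤ invNorm j * ‖a j‖ₑ * (ENNReal.ofReal (freqNorm (m - j)) * ‖b (m - j)‖ₑ) := by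
  have h : ‖((cross m j / freqSq j : ℝ) : ℂ)‖ₑ
      ≤ ENNReal.ofReal (freqNorm (m - j)) * invNorm j := by
    rw [invNorm, ← ENNReal.ofReal_mul (freqNorm_nonneg _), ← cross_sub_left]
    exact enorm_ofReal_le (abs_cross_div_le _ _)
  calc ‖advectionTerm a b m j‖ₑ
      ≤ ENNReal.ofReal (freqNorm (m - j)) * invNorm j * ‖a j‖ₑ * ‖b (m - j)‖ₑ := by
        rw [advectionTerm, enorm_mul, enorm_mul]
        gcongr
    _ = _ := by ring

lemma enorm_inv_two_pi_le : ‖((2 * Real.pi : ℝ) : ℂ)⁻¹‖ₑ ≤ 1 := by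
  rw [← ofReal_norm, norm_inv, Complex.norm_real, Real.norm_of_nonneg Real.two_pi_pos.le,
    ENNReal.ofReal_le_one]
  exact inv_le_one_of_one_le₀ (by linarith [Real.pi_gt_three])

lemma enorm_tsum_le {ι : Type*} (f : ι → ℂ) : ‖∑' i, f i‖ₑ ≤ ∑' i, ‖f i‖ₑ := by
  by_cases h : ∑' i, ‖f i‖ₑ = ⊤
  · simp [h]
  · have hs : Summable fun i => ‖f i‖₊ := tsum_enorm_ne_top_iff_summable_nnnorm.mp h
    simp only [enorm_eq_nnnorm]
    rw [← ENNReal.coe_tsum hs]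
    exact_mod_cast nnnorm_tsum_le hs

/-- The sequence of absolute values of a sequence. -/
noncomputable def absSeq (a : Freq → ℂ) (m : Freq) : ℝ≥0∞ := ‖a m‖ₑ

lemma enorm_advection_le (a b : Freq → ℂ) (m : Freq) :
    ‖advection a b m‖ₑ ≤ ENNReal.ofReal (freqNorm m) * velConv (absSeq a) (absSeq b) m := by
  rw [advection_eq, enorm_mul]
  refine (mul_le_of_le_one_left' enorm_inv_two_pi_le).trans ((enorm_tsum_le _).trans ?_)
  rw [velConv, ← ENNReal.tsum_mul_left]
  exact ENNReal.tsum_le_tsum fun j => enorm_advectionTerm_le a b m j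

lemma enorm_advection_le' (a b : Freq → ℂ) (m : Freq) :
    ‖advection a b m‖ₑ
      ≤ velConv (absSeq a) (fun m => ENNReal.ofReal (freqNorm m) * ‖b m‖ₑ) m := by
  rw [advection_eq, enorm_mul]
  refine (mul_le_of_le_one_left' enorm_inv_two_pi_le).trans ((enorm_tsum_le _).trans ?_)
  exact ENNReal.tsum_le_tsum fun j => enorm_advectionTerm_le' a b m j

lemma normSq_advection_le (a b : Freq → ℂ) :
    normSq (advection a b) ≤ velSum a ^ 2 * gradSq b := by
  have h := tsum_velConv_sq_le (absSeq a) (fun m => ENNReal.ofReal (freqNorm m) * ‖b m‖ₑ)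
  refine (ENNReal.tsum_le_tsum fun m => pow_le_pow_left' (enorm_advection_le' a b m) 2).trans
    (h.trans_eq ?_)
  simp only [mul_pow, ← ENNReal.ofReal_pow (freqNorm_nonneg _), freqNorm_sq]
  rfl

lemma velConv_ne_top {f g : Freq → ℝ≥0∞} (hf : ∑' m, f m ^ 2 ≠ ⊤) (hg : ∑' m, g m ^ 2 ≠ ⊤)
    (m : Freq) : velConv f g m ≠ ⊤ := by
  have h1 : velConv f g m ^ 2 ≤ (∑' j, f j ^ 2) * ∑' j, g (m - j) ^ 2 := by
    refine sq_tsum_le_tsum_mul_tsum fun j => ?_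
    have : invNorm j ≤ 1 := by
      rw [invNorm, ENNReal.ofReal_le_one]
      rcases eq_or_ne j 0 with rfl | hj
      · simp
      · exact inv_le_one_of_one_le₀ (one_le_freqNorm hj)
    calc (invNorm j * f j * g (m - j)) ^ 2 ≤ (1 * f j * g (m - j)) ^ 2 := by gcongr
      _ = _ := by ring
  have h2 : ∑' j, g (m - j) ^ 2 = ∑' l, g l ^ 2 :=
    (Equiv.subLeft m).tsum_eq (fun l => g l ^ 2)
  rw [h2] at h1
  intro h
  rw [h] at h1
  exact ENNReal.mul_ne_top hf hg (top_le_iff.mp (by simpa using h1))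

lemma summable_advectionTerm {a b : Freq → ℂ} (ha : normSq a ≠ ⊤) (hb : normSq b ≠ ⊤)
    (m : Freq) : Summable (advectionTerm a b m) := by
  refine Summable.of_enorm (ne_top_of_le_ne_top ?_
    (ENNReal.tsum_le_tsum fun j => enorm_advectionTerm_le a b m j))
  rw [ENNReal.tsum_mul_left]
  exact ENNReal.mul_ne_top ENNReal.ofReal_ne_top (velConv_ne_top ha hb m)

lemma advection_sub_left {a a' b : Freq → ℂ} (ha : normSq a ≠ ⊤) (ha' : normSq a' ≠ ⊤)
    (hb : normSq b ≠ ⊤) (m : Freq) :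
    advection (a - a') b m = advection a b m - advection a' b m := by
  simp only [advection_eq]
  rw [← mul_sub, ← (summable_advectionTerm ha hb m).tsum_sub (summable_advectionTerm ha' hb m)]
  congr 2
  ext j
  simp only [advectionTerm, Pi.sub_apply]
  ring

lemma advection_sub_right {a b b' : Freq → ℂ} (ha : normSq a ≠ ⊤) (hb : normSq b ≠ ⊤)
    (hb' : normSq b' ≠ ⊤) (m : Freq) :
    advection a (b - b') m = advection a b m - advection a b' m := by
  simp only [advection_eq]
  rw [← mul_sub, ← (summable_advectionTerm ha hb m).tsum_sub (summable_advectionTerm ha hb' m)]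
  congr 2
  ext j
  simp only [advectionTerm, Pi.sub_apply]
  ring

lemma advectionTerm_reflect {a w : Freq → ℂ} (ha : ∀ m, a (-m) = conj (a m)) (m j : Freq) :
    conj (w (m - j)) * advectionTerm a w (m - j) (-j)
      = -conj (conj (w m) * advectionTerm a w m j) := by
  simp only [advectionTerm, cross_neg_right, cross_sub_left, freqSq_neg, ha, sub_neg_eq_add,
    sub_add_cancel, map_mul, Complex.conj_conj, Complex.conj_ofReal]
  push_cast
  ring

/-- The trilinear term `∫ w u · ∇w` vanishes, because `u` is divergence free. In Fourier variables,
the summands cancel in pairs under the involution `(m, j) ↦ (m - j, -j)`. -/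
lemma hasSum_re_conj_mul_advection {a w : Freq → ℂ} (ha : ∀ m, a (-m) = conj (a m))
    (ha2 : normSq a ≠ ⊤) (hv : velSum a ≠ ⊤) (hw : normSq w ≠ ⊤) (hg : gradSq w ≠ ⊤) :
    HasSum (fun m => (conj (w m) * advection a w m).re) 0 := by
  set T : Freq × Freq → ℂ := fun p => conj (w p.1) * advectionTerm a w p.1 p.2 with hT
  have hcs : ∀ j, ∑' m, ENNReal.ofReal (freqNorm m) * ‖w m‖ₑ * ‖w (m - j)‖ₑ
      ≤ 1 + gradSq w * normSq w := by
    intro j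
    have h1 : (∑' m, ENNReal.ofReal (freqNorm m) * ‖w m‖ₑ * ‖w (m - j)‖ₑ) ^ 2
        ≤ gradSq w * ∑' m, ‖w (m - j)‖ₑ ^ 2 := by
      refine sq_tsum_le_tsum_mul_tsum fun m => le_of_eq ?_
      rw [← freqNorm_sq, ENNReal.ofReal_pow (freqNorm_nonneg m)]
      ring
    have h2 : ∑' m, ‖w (m - j)‖ₑ ^ 2 = normSq w :=
      (Equiv.subRight j).tsum_eq (fun m => ‖w m‖ₑ ^ 2)
    rw [h2] at h1
    generalize (∑' m, ENNReal.ofReal (freqNorm m) * ‖w m‖ₑ * ‖w (m - j)‖ₑ) = x at h1 ⊢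
    rcases le_total x 1 with hx | hx
    · exact hx.trans le_self_add
    · calc x = x * 1 := (mul_one x).symm
        _ ≤ x * x := by gcongr
        _ = x ^ 2 := (sq x).symm
        _ ≤ _ := h1.trans le_add_self
  have hsum : Summable T := by
    refine Summable.of_enorm (ne_top_of_le_ne_top ?_ (ENNReal.tsum_le_tsum (g := fun p =>
      invNorm p.2 * ‖a p.2‖ₑ * (ENNReal.ofReal (freqNorm p.1) * ‖w p.1‖ₑ * ‖w (p.1 - p.2)‖ₑ))
      fun p => ?_))
    · rw [ENNReal.tsum_prod', ENNReal.tsum_comm]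
      simp only [ENNReal.tsum_mul_left]
      refine ne_top_of_le_ne_top ?_ (ENNReal.tsum_le_tsum fun j => mul_le_mul_right (hcs j) _)
      rw [ENNReal.tsum_mul_right]
      exact ENNReal.mul_ne_top hv
        (ENNReal.add_ne_top.mpr ⟨ENNReal.one_ne_top, ENNReal.mul_ne_top hg hw⟩)
    · simp only [hT, enorm_mul]
      rw [show ‖conj (w p.1)‖ₑ = ‖w p.1‖ₑ by
        rw [← ofReal_norm, ← ofReal_norm, Complex.norm_conj]]
      calc ‖w p.1‖ₑ * ‖advectionTerm a w p.1 p.2‖ₑ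
          ≤ ‖w p.1‖ₑ * (ENNReal.ofReal (freqNorm p.1)
            * (invNorm p.2 * ‖a p.2‖ₑ * ‖w (p.1 - p.2)‖ₑ)) := by
              gcongr
              exact enorm_advectionTerm_le a w p.1 p.2
        _ = _ := by ring
  have hfib : ∀ m, HasSum (fun j => T (m, j)) (conj (w m) * ∑' j, advectionTerm a w m j) :=
    fun m => (summable_advectionTerm ha2 hw m).hasSum.mul_left _
  have hall := hsum.hasSum.prod_fiberwise hfib
  let σ : Freq × Freq ≃ Freq × Freq :=
    { toFun := fun p => (p.1 - p.2, -p.2)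
      invFun := fun p => (p.1 - p.2, -p.2)
      left_inv := fun p => by simp
      right_inv := fun p => by simp }
  have hre : (∑' p, T p).re = 0 := by
    have h1 : ∑' p, T p = ∑' p, T (σ p) := (σ.tsum_eq T).symm
    have h2 : ∀ p, T (σ p) = -conj (T p) := fun p => advectionTerm_reflect ha p.1 p.2
    simp only [h2, tsum_neg] at h1
    rw [← Complex.conj_tsum] at h1
    have h3 := congrArg Complex.re h1
    rw [Complex.neg_re, Complex.conj_re] at h3
    linarith
  have h4 := (Complex.hasSum_re hall).mul_left (2 * Real.pi)⁻¹
  rw [hre, mul_zero] at h4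
  refine h4.congr_fun fun m => ?_
  rw [advection_eq, mul_left_comm, ← Complex.ofReal_inv, Complex.re_ofReal_mul]


/-! ### One step of the scheme -/

/-- One step of the scheme, solved for the new iterate, in Fourier variables. -/
noncomputable def schemeStep (ν k : ℝ) (g a : Freq → ℂ) (m : Freq) : ℂ :=
  (a m + k * (g m - advection a a m)) / ((1 + k * ν * freqSq m : ℝ) : ℂ)

section Step

variable {ν k : ℝ}

lemma denom_pos (hν : 0 < ν) (hk : 0 < k) (m : Freq) : 0 < 1 + k * ν * freqSq m := by
  have := freqSq_nonneg m
  positivity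

lemma isSchemeStep_iff_hat_eq (hν : 0 < ν) (hk : 0 < k) (g ω ω' : L2dot) :
    IsSchemeStep ν k g ω ω' ↔ hat ω' = schemeStep ν k (hat g) (hat ω) := by
  rw [isSchemeStep_iff, funext_iff]
  refine forall_congr' fun m => ?_
  have h1 : ((1 + k * ν * freqSq m : ℝ) : ℂ) ≠ 0 :=
    Complex.ofReal_ne_zero.mpr (denom_pos hν hk m).ne'
  have h2 : (k : ℂ) ≠ 0 := Complex.ofReal_ne_zero.mpr hk.ne'
  rw [schemeStep, eq_div_iff h1]
  push_cast
  constructor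
  · intro h
    field_simp at h
    linear_combination h
  · intro h
    field_simp
    linear_combination h

/-- The nonlinear part of the step. -/
noncomputable def dampedAdvection (ν k : ℝ) (a b : Freq → ℂ) (m : Freq) : ℂ :=
  k * advection a b m / ((1 + k * ν * freqSq m : ℝ) : ℂ)

/-- If the multiplier `c` satisfies `c² |m|² ≤ C p`, then `c` times the advection term is bounded by
the convolution with weight `p`. -/
lemma enorm_mul_advection_sq_le {c C p : ℝ} (hC : 0 ≤ C) (a b : Freq → ℂ) (m : Freq)
    (h : c ^ 2 * freqSq m ≤ C * p) :
    ‖(c : ℂ) * advection a b m‖ₑ ^ 2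
      ≤ ENNReal.ofReal C * (ENNReal.ofReal p * velConv (absSeq a) (absSeq b) m ^ 2) := by
  calc ‖(c : ℂ) * advection a b m‖ₑ ^ 2
      ≤ (ENNReal.ofReal |c| * (ENNReal.ofReal (freqNorm m)
          * velConv (absSeq a) (absSeq b) m)) ^ 2 := by
        rw [enorm_mul]
        gcongr
        · exact enorm_ofReal_le le_rfl
        · exact enorm_advection_le a b m
    _ = ENNReal.ofReal (c ^ 2 * freqSq m) * velConv (absSeq a) (absSeq b) m ^ 2 := by
        rw [ENNReal.ofReal_mul (sq_nonneg c), ← sq_abs, ← freqNorm_sq,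
          ENNReal.ofReal_pow (abs_nonneg c), ENNReal.ofReal_pow (freqNorm_nonneg m)]
        ring
    _ ≤ _ := by
        rw [← mul_assoc, ← ENNReal.ofReal_mul hC]
        gcongr

lemma dampedAdvection_eq (ν k : ℝ) (a b : Freq → ℂ) (m : Freq) :
    dampedAdvection ν k a b m = ((k / (1 + k * ν * freqSq m) : ℝ) : ℂ) * advection a b m := by
  rw [dampedAdvection]
  push_cast
  ring

/-- The smoothing of the implicit viscous term: the resolvent gains up to four derivatives at the
price of negative powers of `s = √(kν)`. -/
lemma inv_denom_sq_le {s L : ℝ} (hs : 0 < s) (hL : 0 ≤ L) (p : ℕ) (hp : p ≤ 4) :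
    (s * L) ^ p ≤ (1 + s ^ 2 * L ^ 2) ^ 2 := by
  have hy : 0 ≤ s * L := by positivity
  have e : s ^ 2 * L ^ 2 = (s * L) ^ 2 := by ring
  rw [e]
  generalize s * L = y at hy
  interval_cases p <;> nlinarith [sq_nonneg (y - 1), sq_nonneg (y ^ 2 - 1), sq_nonneg (y ^ 2 - y),
    mul_nonneg hy (sq_nonneg (y - 1)), sq_nonneg y, sq_nonneg (y ^ 2)]

/-- The constant in the bound of the nonlinear part of the step. -/
noncomputable def stepConst (ν k : ℝ) : ℝ := k ^ 2 * (Real.sqrt (k * ν))⁻¹ ^ 3 * (2 * latticeSum)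

lemma stepConst_nonneg (ν k : ℝ) : 0 ≤ stepConst ν k := by
  have := latticeSum_nonneg
  unfold stepConst
  positivity

lemma normSq_dampedAdvection_le (hν : 0 < ν) (hk : 0 < k) (a b : Freq → ℂ) :
    normSq (dampedAdvection ν k a b)
      ≤ ENNReal.ofReal (stepConst ν k) * (normSq a * normSq b) := by
  set s := Real.sqrt (k * ν) with hs
  have hs0 : 0 < s := Real.sqrt_pos.mpr (by positivity)
  have hs2 : s ^ 2 = k * ν := Real.sq_sqrt (by positivity)
  have key : ∀ m, ‖dampedAdvection ν k a b m‖ₑ ^ 2 ≤ ENNReal.ofReal (k ^ 2 * s⁻¹ ^ 3)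
      * (invNorm m * velConv (absSeq a) (absSeq b) m ^ 2) := by
    intro m
    rw [dampedAdvection_eq]
    refine enorm_mul_advection_sq_le (by positivity) a b m ?_
    rcases eq_or_ne m 0 with rfl | hm
    · simp [freqSq]
    · have hL := freqNorm_pos hm
      have h := inv_denom_sq_le hs0 hL.le 3 (by norm_num)
      rw [← hs2, ← freqNorm_sq, div_pow, div_mul_eq_mul_div, div_le_iff₀ (by positivity)]
      calc k ^ 2 * freqNorm m ^ 2
          = k ^ 2 * s⁻¹ ^ 3 * (freqNorm m)⁻¹ * (s * freqNorm m) ^ 3 := by field_simp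
        _ ≤ _ := by gcongr
  refine (ENNReal.tsum_le_tsum key).trans ?_
  rw [ENNReal.tsum_mul_left, stepConst, ← hs,
    ENNReal.ofReal_mul (p := k ^ 2 * s⁻¹ ^ 3) (by positivity),
    ENNReal.ofReal_mul zero_le_two, ENNReal.ofReal_ofNat, mul_assoc (ENNReal.ofReal _)]
  gcongr
  refine (tsum_invNorm_mul_velConv_sq_le _ _).trans_eq ?_
  simp only [absSeq, normSq, mul_assoc]

lemma enorm_dampedAdvection_sq_le (hν : 0 < ν) (hk : 0 < k) (a b : Freq → ℂ) (m : Freq) :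
    ‖dampedAdvection ν k a b m‖ₑ ^ 2 ≤ ENNReal.ofReal (k ^ 2 * (Real.sqrt (k * ν))⁻¹ ^ 4)
      * (invNorm m ^ 2 * velConv (absSeq a) (absSeq b) m ^ 2) := by
  set s := Real.sqrt (k * ν) with hs
  have hs0 : 0 < s := Real.sqrt_pos.mpr (by positivity)
  have hs2 : s ^ 2 = k * ν := Real.sq_sqrt (by positivity)
  rw [dampedAdvection_eq, invNorm, ← ENNReal.ofReal_pow (inv_nonneg.mpr (freqNorm_nonneg m))]
  refine enorm_mul_advection_sq_le (by positivity) a b m ?_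
  rcases eq_or_ne m 0 with rfl | hm
  · simp [freqSq]
  · have hL := freqNorm_pos hm
    have h := inv_denom_sq_le hs0 hL.le 4 le_rfl
    rw [← hs2, ← freqNorm_sq, div_pow, div_mul_eq_mul_div, div_le_iff₀ (by positivity)]
    calc k ^ 2 * freqNorm m ^ 2
        = k ^ 2 * s⁻¹ ^ 4 * (freqNorm m)⁻¹ ^ 2 * (s * freqNorm m) ^ 4 := by field_simp
      _ ≤ _ := by gcongr

lemma schemeStep_eq_sub (ν k : ℝ) (g a : Freq → ℂ) (m : Freq) :
    schemeStep ν k g a m = (((1 + k * ν * freqSq m)⁻¹ : ℝ) : ℂ) * (a m + (k : ℂ) * g m)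
      - dampedAdvection ν k a a m := by
  simp only [schemeStep, dampedAdvection]
  push_cast
  ring

lemma enorm_add_three_sq_le (x y z : ℂ) :
    ‖x + y + z‖ₑ ^ 2 ≤ 3 * (‖x‖ₑ ^ 2 + ‖y‖ₑ ^ 2 + ‖z‖ₑ ^ 2) := by
  simp only [enorm_sq_eq_ofReal]
  rw [← ENNReal.ofReal_add (by positivity) (by positivity),
    ← ENNReal.ofReal_add (by positivity) (by positivity), ← ENNReal.ofReal_ofNat 3,
    ← ENNReal.ofReal_mul (by norm_num)]
  exact ENNReal.ofReal_le_ofReal norm_add_three_sq_le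

lemma normSq_add_three_le (a b c : Freq → ℂ) :
    normSq (fun m => a m + b m + c m) ≤ 3 * (normSq a + normSq b + normSq c) := by
  refine (ENNReal.tsum_le_tsum fun m => enorm_add_three_sq_le (a m) (b m) (c m)).trans_eq ?_
  rw [ENNReal.tsum_mul_left, ENNReal.tsum_add, ENNReal.tsum_add]
  rfl

lemma enorm_add_sq_le (x y : ℂ) : ‖x + y‖ₑ ^ 2 ≤ 2 * (‖x‖ₑ ^ 2 + ‖y‖ₑ ^ 2) := by
  simp only [enorm_sq_eq_ofReal]
  rw [← ENNReal.ofReal_add (by positivity) (by positivity), ← ENNReal.ofReal_ofNat 2,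
    ← ENNReal.ofReal_mul (by norm_num)]
  refine ENNReal.ofReal_le_ofReal ?_
  have h := norm_add_le x y
  nlinarith [sq_nonneg (‖x‖ - ‖y‖), norm_nonneg (x + y)]

lemma normSq_add_le (a b : Freq → ℂ) :
    normSq (fun m => a m + b m) ≤ 2 * (normSq a + normSq b) := by
  refine (ENNReal.tsum_le_tsum fun m => enorm_add_sq_le (a m) (b m)).trans_eq ?_
  rw [ENNReal.tsum_mul_left, ENNReal.tsum_add]
  rfl

lemma normSq_mul_le {c : Freq → ℝ} {C : ℝ} (hc : ∀ m, |c m| ≤ C) (a : Freq → ℂ) :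
    normSq (fun m => (c m : ℂ) * a m) ≤ ENNReal.ofReal (C ^ 2) * normSq a := by
  rw [normSq, normSq, ← ENNReal.tsum_mul_left]
  refine ENNReal.tsum_le_tsum fun m => ?_
  have hC : 0 ≤ C := (abs_nonneg _).trans (hc 0)
  rw [enorm_mul, mul_pow, ENNReal.ofReal_pow hC]
  gcongr
  exact enorm_ofReal_le (hc m)

/-- The step is Lipschitz continuous on bounded sets of `L²`. -/
lemma normSq_schemeStep_sub_le (hν : 0 < ν) (hk : 0 < k) {g g' a a' : Freq → ℂ}
    (ha : normSq a ≠ ⊤) (ha' : normSq a' ≠ ⊤) :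
    normSq (schemeStep ν k g a - schemeStep ν k g' a')
      ≤ 3 * (normSq (a - a') + ENNReal.ofReal (k ^ 2) * normSq (g - g')
        + 2 * ENNReal.ofReal (stepConst ν k) * (normSq (a - a') * (normSq a + normSq a'))) := by
  have had : normSq (a - a') ≠ ⊤ := by
    have h := normSq_add_le a (fun m => ((-1 : ℝ) : ℂ) * a' m)
    have h' := normSq_mul_le (c := fun _ => -1) (C := 1) (fun _ => by simp) a'
    have e : a - a' = fun m => a m + ((-1 : ℝ) : ℂ) * a' m := by
      funext m; simp [sub_eq_add_neg]
    rw [e]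
    refine ne_top_of_le_ne_top ?_ h
    refine ENNReal.mul_ne_top (by simp) (ENNReal.add_ne_top.mpr ⟨ha, ne_top_of_le_ne_top ?_ h'⟩)
    exact ENNReal.mul_ne_top ENNReal.ofReal_ne_top ha'
  have hd : ∀ m, |(1 + k * ν * freqSq m)⁻¹| ≤ 1 := fun m => by
    rw [abs_of_pos (inv_pos.mpr (denom_pos hν hk m))]
    refine inv_le_one_of_one_le₀ ?_
    have : 0 ≤ k * ν * freqSq m := mul_nonneg (by positivity) (freqSq_nonneg m)
    linarith
  have e : schemeStep ν k g a - schemeStep ν k g' a'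
      = fun m => (((1 + k * ν * freqSq m)⁻¹ : ℝ) : ℂ) * (a - a') m
        + ((k * (1 + k * ν * freqSq m)⁻¹ : ℝ) : ℂ) * (g - g') m
        + ((-1 : ℝ) : ℂ) * (dampedAdvection ν k (a - a') a m
          + dampedAdvection ν k a' (a - a') m) := by
    funext m
    simp only [Pi.sub_apply, schemeStep, dampedAdvection]
    rw [advection_sub_left ha ha' ha, advection_sub_right ha' ha ha']
    push_cast
    ring
  have h1 := normSq_mul_le hd (a - a')
  have h2 := normSq_mul_le (c := fun m => k * (1 + k * ν * freqSq m)⁻¹) (C := k) (fun m => by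
    rw [abs_mul, abs_of_pos hk]
    exact mul_le_of_le_one_right hk.le (hd m)) (g - g')
  have h3 := normSq_mul_le (c := fun _ => -1) (C := 1) (fun _ => by simp)
    (fun m => dampedAdvection ν k (a - a') a m + dampedAdvection ν k a' (a - a') m)
  have h4 := normSq_add_le (dampedAdvection ν k (a - a') a) (dampedAdvection ν k a' (a - a'))
  have h5 := normSq_dampedAdvection_le hν hk (a - a') a
  have h6 := normSq_dampedAdvection_le hν hk a' (a - a')
  rw [one_pow, ENNReal.ofReal_one, one_mul] at h1 h3
  rw [e]
  refine (normSq_add_three_le _ _ _).trans ?_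
  gcongr
  refine h3.trans (h4.trans ?_)
  calc 2 * (normSq (dampedAdvection ν k (a - a') a) + normSq (dampedAdvection ν k a' (a - a')))
      ≤ 2 * (ENNReal.ofReal (stepConst ν k) * (normSq (a - a') * normSq a)
        + ENNReal.ofReal (stepConst ν k) * (normSq a' * normSq (a - a'))) := by gcongr
    _ = _ := by ring

lemma normSq_zero : normSq 0 = 0 := by simp [normSq]

lemma advection_zero_left (b : Freq → ℂ) (m : Freq) : advection 0 b m = 0 := by
  simp [advection]

lemma schemeStep_zero (ν k : ℝ) : schemeStep ν k 0 0 = 0 := by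
  funext m
  simp [schemeStep, advection_zero_left]

lemma normSq_schemeStep_le (hν : 0 < ν) (hk : 0 < k) {g a : Freq → ℂ} (ha : normSq a ≠ ⊤) :
    normSq (schemeStep ν k g a)
      ≤ 3 * (normSq a + ENNReal.ofReal (k ^ 2) * normSq g
        + 2 * ENNReal.ofReal (stepConst ν k) * (normSq a * normSq a)) := by
  have h := normSq_schemeStep_sub_le hν hk (g := g) (g' := 0) ha (a' := 0) (by simp [normSq_zero])
  simpa only [schemeStep_zero, sub_zero, normSq_zero, add_zero] using h

lemma advection_neg {a b : Freq → ℂ} (ha : ∀ m, a (-m) = conj (a m))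
    (hb : ∀ m, b (-m) = conj (b m)) (m : Freq) : advection a b (-m) = conj (advection a b m) := by
  rw [advection_eq, advection_eq, map_mul, map_inv₀, Complex.conj_ofReal, Complex.conj_tsum,
    ← (Equiv.neg Freq).tsum_eq]
  congr 2
  ext j
  have h : cross (-m) (-j) = cross m j := by simp [cross]
  simp only [Equiv.neg_apply, advectionTerm, h, freqSq_neg, ha, map_mul, Complex.conj_ofReal]
  rw [show -m - -j = -(m - j) by abel, hb]

lemma schemeStep_neg {g a : Freq → ℂ} (hg : ∀ m, g (-m) = conj (g m))
    (ha : ∀ m, a (-m) = conj (a m)) (m : Freq) :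
    schemeStep ν k g a (-m) = conj (schemeStep ν k g a m) := by
  simp only [schemeStep, freqSq_neg, hg, ha, advection_neg ha ha, map_div₀, map_add, map_mul,
    map_sub, Complex.conj_ofReal]

lemma advection_apply_zero (a b : Freq → ℂ) : advection a b 0 = 0 := by
  simp [advection]

lemma schemeStep_apply_zero {g a : Freq → ℂ} (hg : g 0 = 0) (ha : a 0 = 0) :
    schemeStep ν k g a 0 = 0 := by
  simp [schemeStep, hg, ha, advection_apply_zero]

lemma add_sq_le_four_mul (x y : ℝ≥0∞) : (x + y) ^ 2 ≤ 4 * (x ^ 2 + y ^ 2) := by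
  rcases le_total x y with h | h
  · calc (x + y) ^ 2 ≤ (y + y) ^ 2 := by gcongr
      _ = 4 * y ^ 2 := by ring
      _ ≤ _ := by gcongr; exact le_add_self
  · calc (x + y) ^ 2 ≤ (x + x) ^ 2 := by gcongr
      _ = 4 * x ^ 2 := by ring
      _ ≤ _ := by gcongr; exact le_self_add

/-- The bound for the square of the velocity after one step. It is `O(k^{-1/2})` as `k → 0`, so that
its product with `k` becomes small. -/
noncomputable def velBound (ν k A G : ℝ) : ℝ :=
  4 * ((Real.sqrt (k * ν))⁻¹ * latticeSum * (2 * (A + k ^ 2 * G))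
    + k ^ 2 * (Real.sqrt (k * ν))⁻¹ ^ 4 * latticeSum * (2 * latticeSum * (A * A)))

/-- One step of the scheme turns `L²` into a space with bounded velocity. -/
lemma velSum_schemeStep_sq_le (hν : 0 < ν) (hk : 0 < k) {g a : Freq → ℂ} {A G : ℝ} (hA : 0 ≤ A)
    (hG : 0 ≤ G) (ha : normSq a ≤ ENNReal.ofReal A) (hg : normSq g ≤ ENNReal.ofReal G) :
    velSum (schemeStep ν k g a) ^ 2 ≤ ENNReal.ofReal (velBound ν k A G) := by
  set s := Real.sqrt (k * ν) with hs
  have hs0 : 0 < s := Real.sqrt_pos.mpr (by positivity)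
  have hs2 : s ^ 2 = k * ν := Real.sq_sqrt (by positivity)
  have hl := latticeSum_nonneg
  set b : Freq → ℂ := fun m => a m + ((k : ℝ) : ℂ) * g m with hb
  have hbn : normSq b ≤ ENNReal.ofReal (2 * (A + k ^ 2 * G)) := by
    refine (normSq_add_le _ _).trans ?_
    rw [ENNReal.ofReal_mul zero_le_two, ENNReal.ofReal_ofNat,
      ENNReal.ofReal_add hA (by positivity), ENNReal.ofReal_mul (by positivity)]
    gcongr
    refine (normSq_mul_le (c := fun _ => k) (C := k) (fun _ => (abs_of_pos hk).le) g).trans ?_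
    gcongr
  set f1 : Freq → ℝ≥0∞ := fun m => invNorm m
    * ‖(((1 + k * ν * freqSq m)⁻¹ : ℝ) : ℂ) * b m‖ₑ with hf1
  set f2 : Freq → ℝ≥0∞ := fun m => invNorm m * ‖dampedAdvection ν k a a m‖ₑ with hf2
  have hle : velSum (schemeStep ν k g a) ≤ ∑' m, f1 m + ∑' m, f2 m := by
    rw [← ENNReal.tsum_add]
    refine ENNReal.tsum_le_tsum fun m => ?_
    have e : schemeStep ν k g a m
        = (((1 + k * ν * freqSq m)⁻¹ : ℝ) : ℂ) * b m - dampedAdvection ν k a a m :=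
      schemeStep_eq_sub ν k g a m
    rw [e, hf1, hf2, ← mul_add]
    gcongr
    exact enorm_sub_le
  have h1 : (∑' m, f1 m) ^ 2
      ≤ ENNReal.ofReal (s⁻¹ * latticeSum * (2 * (A + k ^ 2 * G))) := by
    have hcs : (∑' m, f1 m) ^ 2 ≤ (∑' m, ENNReal.ofReal s⁻¹ * invNorm m ^ 3) * normSq b := by
      refine sq_tsum_le_tsum_mul_tsum fun m => ?_
      simp only [hf1, enorm_mul, mul_pow]
      rw [← mul_assoc]
      refine mul_le_mul_left ?_ _
      have hL := freqNorm_nonneg m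
      have h := inv_denom_sq_le hs0 hL 1 (by norm_num)
      rw [← ofReal_norm, Complex.norm_real, Real.norm_eq_abs,
        abs_of_pos (inv_pos.mpr (denom_pos hν hk m)), invNorm,
        ← ENNReal.ofReal_pow (by positivity),
        ← ENNReal.ofReal_pow (inv_pos.mpr (denom_pos hν hk m)).le,
        ← ENNReal.ofReal_mul (by positivity), ← ENNReal.ofReal_pow (by positivity),
        ← ENNReal.ofReal_mul (by positivity)]
      apply ENNReal.ofReal_le_ofReal
      rcases hL.eq_or_lt with hL | hL
      · simp [← hL]
      rw [← hs2, ← freqNorm_sq, inv_pow (1 + _), ← div_eq_mul_inv, div_le_iff₀ (by positivity)]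
      calc (freqNorm m)⁻¹ ^ 2 = s⁻¹ * (freqNorm m)⁻¹ ^ 3 * (s * freqNorm m) ^ 1 := by
            field_simp
        _ ≤ _ := by gcongr
    rw [ENNReal.tsum_mul_left, tsum_invNorm_cube, ← ENNReal.ofReal_mul (by positivity)] at hcs
    refine hcs.trans ?_
    rw [ENNReal.ofReal_mul (p := s⁻¹ * latticeSum) (by positivity)]
    gcongr
  have h2 : (∑' m, f2 m) ^ 2 ≤ ENNReal.ofReal
      (k ^ 2 * s⁻¹ ^ 4 * latticeSum * (2 * latticeSum * (A * A))) := by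
    have hcs : (∑' m, f2 m) ^ 2 ≤ (∑' m, ENNReal.ofReal (k ^ 2 * s⁻¹ ^ 4) * invNorm m ^ 3)
        * ∑' m, invNorm m * velConv (absSeq a) (absSeq a) m ^ 2 := by
      refine sq_tsum_le_tsum_mul_tsum fun m => ?_
      have hd := enorm_dampedAdvection_sq_le hν hk a a m
      rw [← hs] at hd
      simp only [hf2, mul_pow]
      calc invNorm m ^ 2 * ‖dampedAdvection ν k a a m‖ₑ ^ 2
          ≤ invNorm m ^ 2 * (ENNReal.ofReal (k ^ 2 * s⁻¹ ^ 4)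
            * (invNorm m ^ 2 * velConv (absSeq a) (absSeq a) m ^ 2)) := by
              gcongr
        _ = _ := by ring
    rw [ENNReal.tsum_mul_left, tsum_invNorm_cube, ← ENNReal.ofReal_mul (by positivity)] at hcs
    refine hcs.trans ?_
    rw [ENNReal.ofReal_mul (p := k ^ 2 * s⁻¹ ^ 4 * latticeSum) (by positivity)]
    gcongr
    refine (tsum_invNorm_mul_velConv_sq_le _ _).trans ?_
    rw [mul_assoc, ENNReal.ofReal_mul (by positivity), ENNReal.ofReal_mul zero_le_two,
      ENNReal.ofReal_ofNat, ENNReal.ofReal_mul hA]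
    gcongr
    · exact ha
    · exact ha
  calc velSum (schemeStep ν k g a) ^ 2 ≤ (∑' m, f1 m + ∑' m, f2 m) ^ 2 := by gcongr
    _ ≤ 4 * ((∑' m, f1 m) ^ 2 + (∑' m, f2 m) ^ 2) := add_sq_le_four_mul _ _
    _ ≤ _ := by
      rw [velBound, ENNReal.ofReal_mul (by norm_num), ENNReal.ofReal_ofNat, ← hs,
        ENNReal.ofReal_add (by positivity) (by positivity)]
      gcongr

/-- If the velocity is bounded, one step of the scheme leads from `L²` to `H¹`. -/
lemma gradSq_schemeStep_ne_top (hν : 0 < ν) (hk : 0 < k) {g a : Freq → ℂ} (ha : normSq a ≠ ⊤)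
    (hg : normSq g ≠ ⊤) (hv : velSum a ≠ ⊤) : gradSq (schemeStep ν k g a) ≠ ⊤ := by
  set s := Real.sqrt (k * ν) with hs
  have hs0 : 0 < s := Real.sqrt_pos.mpr (by positivity)
  have hs2 : s ^ 2 = k * ν := Real.sq_sqrt (by positivity)
  set b : Freq → ℂ := fun m => a m + ((k : ℝ) : ℂ) * g m with hb
  have hbn : normSq b ≠ ⊤ := by
    refine ne_top_of_le_ne_top (ENNReal.mul_ne_top ENNReal.ofNat_ne_top
      (ENNReal.add_ne_top.mpr ⟨ha, ?_⟩)) (normSq_add_le _ _)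
    exact ne_top_of_le_ne_top (ENNReal.mul_ne_top ENNReal.ofReal_ne_top hg)
      (normSq_mul_le (c := fun _ => k) (C := k) (fun _ => (abs_of_pos hk).le) g)
  have hle : ∀ m, ENNReal.ofReal (freqSq m) * ‖schemeStep ν k g a m‖ₑ ^ 2
      ≤ 2 * (ENNReal.ofReal (s⁻¹ ^ 2) * ‖b m‖ₑ ^ 2
        + ENNReal.ofReal (k ^ 2 * s⁻¹ ^ 4) * velConv (absSeq a) (absSeq a) m ^ 2) := by
    intro m
    have h1 : ENNReal.ofReal (freqSq m) * ‖(((1 + k * ν * freqSq m)⁻¹ : ℝ) : ℂ) * b m‖ₑ ^ 2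
        ≤ ENNReal.ofReal (s⁻¹ ^ 2) * ‖b m‖ₑ ^ 2 := by
      rw [enorm_mul, mul_pow, ← mul_assoc]
      refine mul_le_mul_left ?_ _
      rw [← ofReal_norm, Complex.norm_real, Real.norm_eq_abs,
        abs_of_pos (inv_pos.mpr (denom_pos hν hk m)),
        ← ENNReal.ofReal_pow (inv_pos.mpr (denom_pos hν hk m)).le,
        ← ENNReal.ofReal_mul (freqSq_nonneg m)]
      apply ENNReal.ofReal_le_ofReal
      have h := inv_denom_sq_le hs0 (freqNorm_nonneg m) 2 (by norm_num)
      rw [← hs2, ← freqNorm_sq, inv_pow (1 + _), ← div_eq_mul_inv, div_le_iff₀ (by positivity)]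
      calc freqNorm m ^ 2 = s⁻¹ ^ 2 * (s * freqNorm m) ^ 2 := by field_simp
        _ ≤ _ := by gcongr
    have h2 : ENNReal.ofReal (freqSq m) * ‖-dampedAdvection ν k a a m‖ₑ ^ 2
        ≤ ENNReal.ofReal (k ^ 2 * s⁻¹ ^ 4) * velConv (absSeq a) (absSeq a) m ^ 2 := by
      have hd := enorm_dampedAdvection_sq_le hν hk a a m
      rw [← hs] at hd
      have hq : ENNReal.ofReal (freqSq m) * invNorm m ^ 2 ≤ 1 := by
        rw [invNorm, ← ENNReal.ofReal_pow (inv_nonneg.mpr (freqNorm_nonneg m)),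
          ← ENNReal.ofReal_mul (freqSq_nonneg m), ENNReal.ofReal_le_one, ← freqNorm_sq, ← mul_pow]
        exact pow_le_one₀ (mul_nonneg (freqNorm_nonneg m) (inv_nonneg.mpr (freqNorm_nonneg m)))
          mul_inv_le_one
      rw [enorm_neg]
      calc ENNReal.ofReal (freqSq m) * ‖dampedAdvection ν k a a m‖ₑ ^ 2
          ≤ ENNReal.ofReal (freqSq m) * (ENNReal.ofReal (k ^ 2 * s⁻¹ ^ 4)
            * (invNorm m ^ 2 * velConv (absSeq a) (absSeq a) m ^ 2)) := by gcongr
        _ = (ENNReal.ofReal (freqSq m) * invNorm m ^ 2) * (ENNReal.ofReal (k ^ 2 * s⁻¹ ^ 4)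
            * velConv (absSeq a) (absSeq a) m ^ 2) := by ring
        _ ≤ 1 * (ENNReal.ofReal (k ^ 2 * s⁻¹ ^ 4)
            * velConv (absSeq a) (absSeq a) m ^ 2) := by gcongr
        _ = _ := one_mul _
    have e : schemeStep ν k g a m
        = (((1 + k * ν * freqSq m)⁻¹ : ℝ) : ℂ) * b m + -dampedAdvection ν k a a m :=
      (schemeStep_eq_sub ν k g a m).trans (sub_eq_add_neg _ _)
    rw [e]
    calc _ ≤ ENNReal.ofReal (freqSq m) * (2 * (‖(((1 + k * ν * freqSq m)⁻¹ : ℝ) : ℂ) * b m‖ₑ ^ 2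
          + ‖-dampedAdvection ν k a a m‖ₑ ^ 2)) := by
          gcongr
          exact enorm_add_sq_le _ _
      _ = 2 * (ENNReal.ofReal (freqSq m) * ‖(((1 + k * ν * freqSq m)⁻¹ : ℝ) : ℂ) * b m‖ₑ ^ 2
          + ENNReal.ofReal (freqSq m) * ‖-dampedAdvection ν k a a m‖ₑ ^ 2) := by ring
      _ ≤ _ := by gcongr
  refine ne_top_of_le_ne_top ?_ (ENNReal.tsum_le_tsum hle)
  rw [ENNReal.tsum_mul_left, ENNReal.tsum_add, ENNReal.tsum_mul_left, ENNReal.tsum_mul_left]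
  refine ENNReal.mul_ne_top ENNReal.ofNat_ne_top (ENNReal.add_ne_top.mpr
    ⟨ENNReal.mul_ne_top ENNReal.ofReal_ne_top hbn, ENNReal.mul_ne_top ENNReal.ofReal_ne_top ?_⟩)
  exact ne_top_of_le_ne_top (ENNReal.mul_ne_top (ENNReal.pow_ne_top hv) ha)
    (tsum_velConv_sq_le (absSeq a) (absSeq a))

lemma hasSum_norm_sq {a : Freq → ℂ} (ha : normSq a ≠ ⊤) :
    HasSum (fun m => ‖a m‖ ^ 2) (normSq a).toReal := by
  rw [normSq, ENNReal.tsum_toReal_eq fun m => ENNReal.pow_ne_top enorm_ne_top]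
  simpa only [ENNReal.toReal_pow, toReal_enorm] using ENNReal.hasSum_toReal ha

lemma hasSum_freqSq_mul_norm_sq {a : Freq → ℂ} (ha : gradSq a ≠ ⊤) :
    HasSum (fun m => freqSq m * ‖a m‖ ^ 2) (gradSq a).toReal := by
  rw [gradSq, ENNReal.tsum_toReal_eq fun m =>
    ENNReal.mul_ne_top ENNReal.ofReal_ne_top (ENNReal.pow_ne_top enorm_ne_top)]
  simpa only [ENNReal.toReal_mul, ENNReal.toReal_ofReal (freqSq_nonneg _), ENNReal.toReal_pow,
    toReal_enorm] using ENNReal.hasSum_toReal ha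

/-- The energy inequality for one step. The explicit treatment of the transport term costs
`‖u‖² ‖w - a‖²`, where `w` is the new iterate; for small `k` this is absorbed by the numerical
dissipation `‖w - a‖²` of the implicit Euler method. -/
lemma normSq_add_gradSq_schemeStep_le (hν : 0 < ν) (hk : 0 < k) {g a : Freq → ℂ}
    (hsymm : ∀ m, a (-m) = conj (a m)) (ha0 : a 0 = 0) (hg0 : g 0 = 0) (ha : normSq a ≠ ⊤)
    (hg : normSq g ≠ ⊤) (hv : velSum a ≠ ⊤) (hsmall : 2 * k / ν * (velSum a).toReal ^ 2 ≤ 1) :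
    (normSq (schemeStep ν k g a)).toReal + k * ν * (gradSq (schemeStep ν k g a)).toReal
      ≤ (normSq a).toReal + 2 * k / ν * (normSq g).toReal := by
  set w := schemeStep ν k g a with hw
  have hwg : gradSq w ≠ ⊤ := gradSq_schemeStep_ne_top hν hk ha hg hv
  have hwn : normSq w ≠ ⊤ :=
    ne_top_of_le_ne_top hwg (normSq_le_gradSq (schemeStep_apply_zero hg0 ha0))
  have hδn : normSq (w - a) ≠ ⊤ := by
    have h := normSq_add_le w (fun m => ((-1 : ℝ) : ℂ) * a m)
    have h' := normSq_mul_le (c := fun _ => -1) (C := 1) (fun _ => by simp) a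
    have e : w - a = fun m => w m + ((-1 : ℝ) : ℂ) * a m := by
      funext m; simp [sub_eq_add_neg]
    rw [e]
    refine ne_top_of_le_ne_top (ENNReal.mul_ne_top ENNReal.ofNat_ne_top
      (ENNReal.add_ne_top.mpr ⟨hwn, ne_top_of_le_ne_top ?_ h'⟩)) h
    exact ENNReal.mul_ne_top ENNReal.ofReal_ne_top ha
  have hcle := tsum_velConv_sq_le (absSeq a) (absSeq (w - a))
  have hCfin : ∑' m, velConv (absSeq a) (absSeq (w - a)) m ^ 2 ≠ ⊤ :=
    ne_top_of_le_ne_top (ENNReal.mul_ne_top (ENNReal.pow_ne_top hv) hδn) hcle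
  set c : Freq → ℝ := fun m => (velConv (absSeq a) (absSeq (w - a)) m).toReal with hc
  have hcfin : ∀ m, velConv (absSeq a) (absSeq (w - a)) m ≠ ⊤ := velConv_ne_top ha hδn
  have Hc : HasSum (fun m => c m ^ 2)
      (∑' m, velConv (absSeq a) (absSeq (w - a)) m ^ 2).toReal := by
    have h := (ENNReal.summable_toReal hCfin).hasSum
    rw [← ENNReal.tsum_toReal_eq fun m => ENNReal.pow_ne_top (hcfin m)] at h
    simpa only [ENNReal.toReal_pow] using h
  have hC : (∑' m, velConv (absSeq a) (absSeq (w - a)) m ^ 2).toReal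
      ≤ (velSum a).toReal ^ 2 * (normSq (w - a)).toReal := by
    rw [← ENNReal.toReal_pow, ← ENNReal.toReal_mul]
    exact ENNReal.toReal_mono (ENNReal.mul_ne_top (ENNReal.pow_ne_top hv) hδn) hcle
  have H0 := hasSum_re_conj_mul_advection hsymm ha hv hwn hwg
  have key : ∀ m, ‖w m‖ ^ 2 + k * ν * (freqSq m * ‖w m‖ ^ 2) + ‖(w - a) m‖ ^ 2
      + 2 * k * (conj (w m) * advection a w m).re
      ≤ ‖a m‖ ^ 2 + 2 * k / ν * ‖g m‖ ^ 2 + 2 * k / ν * c m ^ 2 := by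
    intro m
    have hB : ‖advection a (w - a) m‖ ≤ freqNorm m * c m := by
      have h := enorm_advection_le a (w - a) m
      have h2 := ENNReal.toReal_mono (ENNReal.mul_ne_top ENNReal.ofReal_ne_top (hcfin m)) h
      rwa [toReal_enorm, ENNReal.toReal_mul, ENNReal.toReal_ofReal (freqNorm_nonneg m)] at h2
    have hBs := advection_sub_right ha hwn ha m
    have hne : ((1 + k * ν * freqSq m : ℝ) : ℂ) ≠ 0 :=
      Complex.ofReal_ne_zero.mpr (denom_pos hν hk m).ne'
    have heq : ((1 + k * ν * freqSq m : ℝ) : ℂ) * w m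
        = a m + k * (g m - advection a a m) := by
      rw [hw, schemeStep, mul_div_cancel₀ _ hne]
    have hre := congrArg (fun z => (conj (w m) * z).re) (show
      ((k * ν * freqSq m : ℝ) : ℂ) * w m + (w - a) m = (k : ℂ) * (g m
        - advection a w m + advection a (w - a) m) by
      rw [hBs, Pi.sub_apply]
      push_cast at heq ⊢
      linear_combination heq)
    have e1 : (conj (w m) * (((k * ν * freqSq m : ℝ) : ℂ) * w m + (w - a) m)).re
        = k * ν * freqSq m * ‖w m‖ ^ 2 + (conj (w m) * (w - a) m).re := by
      rw [mul_add, Complex.add_re, mul_left_comm, Complex.re_ofReal_mul, mul_comm (conj (w m)) (w m),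
        Complex.mul_conj, Complex.ofReal_re, Complex.normSq_eq_norm_sq]
    have e2 : (conj (w m) * ((k : ℂ) * (g m - advection a w m + advection a (w - a) m))).re
        = k * ((conj (w m) * g m).re - (conj (w m) * advection a w m).re
          + (conj (w m) * advection a (w - a) m).re) := by
      rw [mul_left_comm, Complex.re_ofReal_mul, mul_add, mul_sub, Complex.add_re, Complex.sub_re]
    have e3 : 2 * (conj (w m) * (w - a) m).re = ‖w m‖ ^ 2 + ‖(w - a) m‖ ^ 2 - ‖a m‖ ^ 2 := by
      simp only [← Complex.normSq_eq_norm_sq, Complex.normSq_apply, Pi.sub_apply, Complex.mul_re,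
        Complex.sub_re, Complex.sub_im, Complex.conj_re, Complex.conj_im]
      ring
    have b1 : (conj (w m) * g m).re ≤ ‖w m‖ * ‖g m‖ := by
      refine (Complex.re_le_norm _).trans_eq ?_
      rw [norm_mul, Complex.norm_conj]
    have b2 : (conj (w m) * advection a (w - a) m).re ≤ ‖w m‖ * (freqNorm m * c m) := by
      refine (Complex.re_le_norm _).trans ?_
      rw [norm_mul, Complex.norm_conj]
      gcongr
    simp only [e1, e2] at hre
    have a1 : 2 * (‖w m‖ * ‖g m‖) ≤ ν / 2 * (freqSq m * ‖w m‖ ^ 2) + 2 / ν * ‖g m‖ ^ 2 := by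
      rcases eq_or_ne m 0 with rfl | hm
      · have hw0 : w 0 = 0 := schemeStep_apply_zero hg0 ha0
        rw [hw0]
        simp only [norm_zero, zero_mul, mul_zero, ne_eq, OfNat.ofNat_ne_zero, not_false_eq_true,
          zero_pow, zero_add]
        positivity
      · have hq := one_le_freqSq hm
        have h1 : 0 ≤ (ν * ‖w m‖ - 2 * ‖g m‖) ^ 2 / (2 * ν) := by positivity
        have h2 : (ν * ‖w m‖ - 2 * ‖g m‖) ^ 2 / (2 * ν)
            = ν / 2 * ‖w m‖ ^ 2 + 2 / ν * ‖g m‖ ^ 2 - 2 * (‖w m‖ * ‖g m‖) := by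
          field_simp
          ring
        have h3 : ‖w m‖ ^ 2 ≤ freqSq m * ‖w m‖ ^ 2 := le_mul_of_one_le_left (by positivity) hq
        nlinarith
    have a2 : 2 * (‖w m‖ * (freqNorm m * c m))
        ≤ ν / 2 * (freqSq m * ‖w m‖ ^ 2) + 2 / ν * c m ^ 2 := by
      have h1 : 0 ≤ (ν * (freqNorm m * ‖w m‖) - 2 * c m) ^ 2 / (2 * ν) := by positivity
      have h2 : (ν * (freqNorm m * ‖w m‖) - 2 * c m) ^ 2 / (2 * ν)
          = ν / 2 * (freqNorm m ^ 2 * ‖w m‖ ^ 2) + 2 / ν * c m ^ 2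
            - 2 * (‖w m‖ * (freqNorm m * c m)) := by
        field_simp
        ring
      rw [freqNorm_sq] at h2
      linarith
    have f1 := mul_le_mul_of_nonneg_left (b1.trans (by linarith : ‖w m‖ * ‖g m‖
      ≤ (ν / 2 * (freqSq m * ‖w m‖ ^ 2) + 2 / ν * ‖g m‖ ^ 2) / 2)) hk.le
    have f2 := mul_le_mul_of_nonneg_left (b2.trans (by linarith : ‖w m‖ * (freqNorm m * c m)
      ≤ (ν / 2 * (freqSq m * ‖w m‖ ^ 2) + 2 / ν * c m ^ 2) / 2)) hk.le
    have g1 : 2 * k / ν = k * (2 / ν) := by ring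
    rw [g1]
    linarith
  have hfin := hasSum_le key
    ((((hasSum_norm_sq hwn).add ((hasSum_freqSq_mul_norm_sq hwg).mul_left (k * ν))).add
      (hasSum_norm_sq hδn)).add (H0.mul_left (2 * k)))
    (((hasSum_norm_sq ha).add ((hasSum_norm_sq hg).mul_left (2 * k / ν))).add
      (Hc.mul_left (2 * k / ν)))
  have h1 : 2 * k / ν * (∑' m, velConv (absSeq a) (absSeq (w - a)) m ^ 2).toReal
      ≤ (normSq (w - a)).toReal :=
    calc _ ≤ 2 * k / ν * ((velSum a).toReal ^ 2 * (normSq (w - a)).toReal) := by gcongr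
      _ = 2 * k / ν * (velSum a).toReal ^ 2 * (normSq (w - a)).toReal := by ring
      _ ≤ 1 * (normSq (w - a)).toReal := by gcongr
      _ = _ := one_mul _
  linarith

/-- Growth of the gradient in one step, by comparing Fourier modes. -/
lemma gradSq_schemeStep_le (hν : 0 < ν) (hk : 0 < k) (g a : Freq → ℂ) :
    gradSq (schemeStep ν k g a) ≤ gradSq a + ENNReal.ofReal (k / ν)
      * (2 * (normSq g + ENNReal.ofReal latticeSum * gradSq a ^ 2)) := by
  have hmode : ∀ m, freqSq m * ‖schemeStep ν k g a m‖ ^ 2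
      ≤ freqSq m * ‖a m‖ ^ 2 + k / ν * ‖g m + ((-1 : ℝ) : ℂ) * advection a a m‖ ^ 2 := by
    intro m
    set h := g m + ((-1 : ℝ) : ℂ) * advection a a m with hh
    have hw : ‖schemeStep ν k g a m‖ * (1 + k * ν * freqSq m) ≤ ‖a m‖ + k * ‖h‖ := by
      have e : schemeStep ν k g a m = (a m + k * h) / ((1 + k * ν * freqSq m : ℝ) : ℂ) := by
        rw [schemeStep, hh]
        push_cast
        ring
      rw [e, norm_div, Complex.norm_real, Real.norm_of_nonneg (denom_pos hν hk m).le,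
        div_mul_cancel₀ _ (denom_pos hν hk m).ne']
      refine (norm_add_le _ _).trans_eq ?_
      rw [norm_mul, Complex.norm_real, Real.norm_of_nonneg hk.le]
    have hy0 := norm_nonneg (schemeStep ν k g a m)
    generalize ‖schemeStep ν k g a m‖ = y at hw hy0
    generalize ‖a m‖ = A at hw
    generalize ‖h‖ = H at hw
    rcases (freqSq_nonneg m).eq_or_lt with hq | hq
    · rw [← hq]
      simp only [zero_mul, zero_add]
      positivity
    · generalize freqSq m = q at hw hq
      have hx : 0 < k * ν * q := by positivity
      have h1 : (y * (1 + k * ν * q)) ^ 2 ≤ (A + k * H) ^ 2 := by gcongr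
      have h2 : 0 ≤ q * ((k * ν * q * A - k * H) ^ 2 / (k * ν * q)) := by positivity
      have h3 : q * ((k * ν * q * A - k * H) ^ 2 / (k * ν * q))
          = (1 + k * ν * q) * (q * A ^ 2 + k / ν * H ^ 2) - q * (A + k * H) ^ 2 := by
        field_simp
        ring
      have h4 : q * (y * (1 + k * ν * q)) ^ 2 ≤ q * (A + k * H) ^ 2 := by gcongr
      have h5 : (1 + k * ν * q) * (q * y ^ 2 * (1 + k * ν * q))
          ≤ (1 + k * ν * q) * (q * A ^ 2 + k / ν * H ^ 2) := by nlinarith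
      have h6 := le_of_mul_le_mul_left h5 (by positivity)
      have h7 : q * y ^ 2 * 1 ≤ q * y ^ 2 * (1 + k * ν * q) := by
        gcongr
        linarith
      linarith
  have hB : normSq (fun m => g m + ((-1 : ℝ) : ℂ) * advection a a m)
      ≤ 2 * (normSq g + ENNReal.ofReal latticeSum * gradSq a ^ 2) := by
    refine (normSq_add_le _ _).trans ?_
    gcongr
    have h3 := normSq_mul_le (c := fun _ => -1) (C := 1) (fun _ => by simp) (advection a a)
    rw [one_pow, ENNReal.ofReal_one, one_mul] at h3
    calc _ ≤ normSq (advection a a) := h3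
      _ ≤ velSum a ^ 2 * gradSq a := normSq_advection_le a a
      _ ≤ ENNReal.ofReal latticeSum * gradSq a * gradSq a := by
          gcongr
          exact velSum_sq_le_gradSq a
      _ = _ := by ring
  calc gradSq (schemeStep ν k g a)
      ≤ ∑' m, (ENNReal.ofReal (freqSq m) * ‖a m‖ₑ ^ 2
        + ENNReal.ofReal (k / ν) * ‖g m + ((-1 : ℝ) : ℂ) * advection a a m‖ₑ ^ 2) := by
        refine ENNReal.tsum_le_tsum fun m => ?_
        simp only [enorm_sq_eq_ofReal]
        rw [← ENNReal.ofReal_mul (freqSq_nonneg m), ← ENNReal.ofReal_mul (freqSq_nonneg m),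
          ← ENNReal.ofReal_mul (by positivity),
          ← ENNReal.ofReal_add (mul_nonneg (freqSq_nonneg m) (by positivity)) (by positivity)]
        exact ENNReal.ofReal_le_ofReal (hmode m)
    _ = gradSq a + ENNReal.ofReal (k / ν)
        * normSq (fun m => g m + ((-1 : ℝ) : ℂ) * advection a a m) := by
        rw [ENNReal.tsum_add, ENNReal.tsum_mul_left]
        rfl
    _ ≤ _ := by gcongr

end Step


/-! ### The discrete semigroup -/

lemma normSq_hat (u : L2) : normSq (hat u) = ENNReal.ofReal (‖u‖ ^ 2) := by
  have h := hasSum_norm_hat_sq u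
  rw [← h.tsum_eq, ENNReal.ofReal_tsum_of_nonneg (fun _ => by positivity) h.summable]
  exact tsum_congr fun m => enorm_sq_eq_ofReal _

lemma normSq_hat_ne_top (u : L2) : normSq (hat u) ≠ ⊤ := by
  rw [normSq_hat]
  exact ENNReal.ofReal_ne_top

lemma exists_hat_eq_schemeStep {ν k : ℝ} (hν : 0 < ν) (hk : 0 < k) (g ω : L2dot) :
    ∃ ω' : L2dot, hat ω' = schemeStep ν k (hat g) (hat ω) := by
  refine exists_L2dot_hat_eq (hasSum_norm_sq ?_).summable
    (schemeStep_neg (hat_neg _) (hat_neg _))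
    (schemeStep_apply_zero (hat_coe_zero _) (hat_coe_zero _))
  refine ne_top_of_le_ne_top ?_ (normSq_schemeStep_le hν hk (normSq_hat_ne_top _))
  have h := normSq_hat_ne_top (ω : L2)
  have h' := normSq_hat_ne_top (g : L2)
  finiteness

lemma norm_sub_sq_le_of_hat_eq {ν k : ℝ} (hν : 0 < ν) (hk : 0 < k) {g g₁ ω ω₁ ω' ω₁' : L2dot}
    (h : hat ω' = schemeStep ν k (hat g) (hat ω))
    (h₁ : hat ω₁' = schemeStep ν k (hat g₁) (hat ω₁)) :
    ‖ω' - ω₁'‖ ^ 2 ≤ 3 * (‖ω - ω₁‖ ^ 2 + k ^ 2 * ‖g - g₁‖ ^ 2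
      + 2 * stepConst ν k * (‖ω - ω₁‖ ^ 2 * (‖ω‖ ^ 2 + ‖ω₁‖ ^ 2))) := by
  have key := normSq_schemeStep_sub_le hν hk (g := hat g) (g' := hat g₁)
    (normSq_hat_ne_top (ω : L2)) (normSq_hat_ne_top (ω₁ : L2))
  have hsub : ∀ u v : L2dot, hat (u : L2) - hat (v : L2) = hat ((u - v : L2dot) : L2) := by
    intro u v
    funext m
    rw [Pi.sub_apply, Submodule.coe_sub, hat_sub]
  have hc := stepConst_nonneg ν k
  rw [← h, ← h₁, hsub, hsub, hsub] at key
  simp only [normSq_hat] at key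
  refine (ENNReal.ofReal_le_ofReal_iff (by positivity)).mp (key.trans_eq ?_)
  rw [ENNReal.ofReal_mul (p := 3) (by norm_num), ENNReal.ofReal_add (by positivity) (by positivity),
    ENNReal.ofReal_add (by positivity) (by positivity), ENNReal.ofReal_mul (p := k ^ 2)
    (by positivity), ENNReal.ofReal_mul (p := 2 * stepConst ν k) (by positivity),
    ENNReal.ofReal_mul (p := 2) (by norm_num), ENNReal.ofReal_mul (by positivity),
    ENNReal.ofReal_add (by positivity) (by positivity), ENNReal.ofReal_ofNat, ENNReal.ofReal_ofNat]
  rfl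

lemma exists_continuous_step {ν k : ℝ} (hν : 0 < ν) (hk : 0 < k) :
    ∃ S : L2dot × L2dot → L2dot, Continuous S ∧
      ∀ g ω ω' : L2dot, IsSchemeStep ν k g ω ω' ↔ ω' = S (ω, g) := by
  choose S hS using fun p : L2dot × L2dot => exists_hat_eq_schemeStep hν hk p.2 p.1
  refine ⟨S, ?_, fun g ω ω' => ?_⟩
  · rw [continuous_iff_continuousAt]
    intro p
    rw [ContinuousAt, tendsto_iff_norm_sub_tendsto_zero]
    have hb : Filter.Tendsto (fun q : L2dot × L2dot => 3 * (‖q.1 - p.1‖ ^ 2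
        + k ^ 2 * ‖q.2 - p.2‖ ^ 2
        + 2 * stepConst ν k * (‖q.1 - p.1‖ ^ 2 * (‖q.1‖ ^ 2 + ‖p.1‖ ^ 2)))) (nhds p) (nhds 0) := by
      have hcont : Continuous (fun q : L2dot × L2dot => 3 * (‖q.1 - p.1‖ ^ 2
        + k ^ 2 * ‖q.2 - p.2‖ ^ 2
        + 2 * stepConst ν k * (‖q.1 - p.1‖ ^ 2 * (‖q.1‖ ^ 2 + ‖p.1‖ ^ 2)))) := by fun_prop
      have := hcont.tendsto p
      simpa using this
    have hsq : Filter.Tendsto (fun q => ‖S q - S p‖ ^ 2) (nhds p) (nhds 0) :=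
      squeeze_zero (fun _ => by positivity)
        (fun q => norm_sub_sq_le_of_hat_eq hν hk (hS q) (hS p)) hb
    have := hsq.sqrt
    simpa using this
  · rw [isSchemeStep_iff_hat_eq hν hk, ← hS (ω, g)]
    exact ⟨fun h => Subtype.ext (hat_injective h), fun h => by rw [h]⟩

/-- The iterates of a continuous map, as a flow. -/
def iterateFlow {X : Type*} [TopologicalSpace X] (f : X → X) (hf : Continuous f) : Flow ℕ X where
  toFun n := f^[n]
  cont' := continuous_prod_of_discrete_left.mpr fun n => hf.iterate n
  map_add' m n x := Function.iterate_add_apply f m n x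
  map_zero' _ := rfl

lemma exists_flow {ν k : ℝ} (hν : 0 < ν) (hk : 0 < k) (g : L2dot) :
    ∃ Φ : Flow ℕ L2dot, ∀ ω₀ : L2dot,
      IsSchemeSolution ν k (fun _ => g) (fun n => Φ n ω₀) := by
  obtain ⟨S, hS, h⟩ := exists_continuous_step hν hk
  have hf : Continuous fun ω => S (ω, g) := by fun_prop
  exact ⟨iterateFlow _ hf, fun ω₀ n => (h _ _ _).mpr (Function.iterate_succ_apply' _ n ω₀)⟩

/-! ### Discrete Gronwall inequalities -/

/-- The uniform Gronwall inequality, for recurrences with quadratic growth over a window of length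
between `1` and `2`. A small value inside the window is provided by the bound of the sum. -/
lemma uniform_gronwall {d : ℕ → ℝ} {k α β R : ℝ} {p : ℕ} (hd : ∀ i, 0 ≤ d i) (hk : 0 < k)
    (hα : 0 ≤ α) (hβ : 0 ≤ β) (hR : 0 ≤ R) (hp1 : 1 ≤ p * k) (hp2 : p * k ≤ 2)
    (hstep : ∀ i, d (i + 1) ≤ d i * (1 + k * α * d i) + k * β)
    (hsum : k * ∑ i ∈ Finset.range p, d i ≤ R) :
    d p ≤ (R + 2 * β) * Real.exp (α * R) := by
  obtain ⟨i, hip, hi⟩ : ∃ i < p, d i ≤ R := by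
    by_contra! hcon
    have hp0 : 0 < p := by
      rcases Nat.eq_zero_or_pos p with rfl | h
      · norm_num at hp1
      · exact h
    have h1 : ∑ _i ∈ Finset.range p, R < ∑ i ∈ Finset.range p, d i :=
      Finset.sum_lt_sum_of_nonempty (Finset.nonempty_range_iff.mpr hp0.ne')
        fun i hi => hcon i (Finset.mem_range.mp hi)
    rw [Finset.sum_const, Finset.card_range, nsmul_eq_mul] at h1
    have h2 : k * (p * R) < k * ∑ i ∈ Finset.range p, d i := mul_lt_mul_of_pos_left h1 hk
    nlinarith
  have hind : ∀ j : ℕ, d (i + j) ≤ (R + j * k * β)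
      * Real.exp (α * (k * ∑ l ∈ Finset.Ico i (i + j), d l)) := by
    intro j
    induction j with
    | zero => simpa using hi
    | succ j ih =>
      have hS : ∑ l ∈ Finset.Ico i (i + (j + 1)), d l
          = ∑ l ∈ Finset.Ico i (i + j), d l + d (i + j) :=
        Finset.sum_Ico_succ_top (Nat.le_add_right i j) d
      set S := ∑ l ∈ Finset.Ico i (i + j), d l with hSdef
      have hS0 : 0 ≤ S := Finset.sum_nonneg fun l _ => hd l
      have hD := hd (i + j)
      have e1 : 1 + k * α * d (i + j) ≤ Real.exp (k * α * d (i + j)) := by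
        linarith [Real.add_one_le_exp (k * α * d (i + j))]
      have e2 : 1 ≤ Real.exp (α * (k * (S + d (i + j)))) := Real.one_le_exp (by positivity)
      rw [hS, ← add_assoc]
      calc d (i + j + 1) ≤ d (i + j) * (1 + k * α * d (i + j)) + k * β := hstep _
        _ ≤ ((R + j * k * β) * Real.exp (α * (k * S))) * Real.exp (k * α * d (i + j))
            + k * β * Real.exp (α * (k * (S + d (i + j)))) := by
            refine add_le_add ?_ (le_mul_of_one_le_right (by positivity) e2)
            gcongr
        _ = (R + (j + 1 : ℕ) * k * β) * Real.exp (α * (k * (S + d (i + j)))) := by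
            have : α * (k * (S + d (i + j))) = α * (k * S) + k * α * d (i + j) := by ring
            rw [this, Real.exp_add]
            push_cast
            ring
  obtain ⟨j, rfl⟩ := Nat.exists_eq_add_of_lt hip
  have h := hind (j + 1)
  rw [← add_assoc] at h
  refine h.trans ?_
  have hsub : ∑ l ∈ Finset.Ico i (i + j + 1), d l ≤ ∑ l ∈ Finset.range (i + j + 1), d l := by
    refine Finset.sum_le_sum_of_subset_of_nonneg (fun l hl => ?_) fun l _ _ => hd l
    exact Finset.mem_range.mpr (Finset.mem_Ico.mp hl).2
  have hjk : ((j + 1 : ℕ) : ℝ) * k ≤ 2 := by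
    refine le_trans ?_ hp2
    gcongr
    omega
  have h1 : k * ∑ l ∈ Finset.Ico i (i + j + 1), d l ≤ R :=
    (mul_le_mul_of_nonneg_left hsub hk.le).trans hsum
  gcongr

/-- The sum of the gradients over a window is controlled by the energy inequality. -/
lemma sum_grad_le {E d : ℕ → ℝ} {k ν G : ℝ} {N : ℕ}
    (hE : ∀ n, N ≤ n → E (n + 1) + k * ν * d (n + 1) ≤ E n + 2 * k / ν * G) (p : ℕ) :
    E (N + p) + k * ν * ∑ i ∈ Finset.range p, d (N + 1 + i) ≤ E N + p * (2 * k / ν * G) := by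
  induction p with
  | zero => simp
  | succ p ih =>
    have h := hE (N + p) (Nat.le_add_right _ _)
    rw [Finset.sum_range_succ, show N + 1 + p = N + p + 1 by ring, ← add_assoc]
    push_cast
    linarith

/-! ### Long time stability -/

/-- The restriction on the time step that the argument needs can be met: all quantities involved are
`O(√k)`. -/
lemma exists_time_step {ν A G : ℝ} (hν : 0 < ν) (hA : 0 ≤ A) (hG : 0 ≤ G) :
    ∃ k₀ > 0, ∀ k, 0 < k → k < k₀ →
      k ≤ 1 ∧ stepConst ν k ≤ 1 ∧ 2 * k / ν * velBound ν k A G ≤ 1 := by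
  have hl := latticeSum_nonneg
  set P : ℝ := 2 * latticeSum / ν ^ 2 + 8 / ν ^ 2 * (2 * latticeSum * (A + G)
    + 2 * latticeSum ^ 2 * A ^ 2 / ν ^ 2) with hP
  have hP0 : 0 ≤ P := by positivity
  refine ⟨min 1 ((1 / (1 + P)) ^ 2 / ν), by positivity, fun k hk hk0 => ?_⟩
  have hk1 : k ≤ 1 := (hk0.trans_le (min_le_left _ _)).le
  have hk2 : k * ν < (1 / (1 + P)) ^ 2 := (lt_div_iff₀ hν).mp (hk0.trans_le (min_le_right _ _))
  have hs0 : 0 < Real.sqrt (k * ν) := Real.sqrt_pos.mpr (by positivity)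
  have hs1 : Real.sqrt (k * ν) < 1 / (1 + P) := (Real.sqrt_lt' (by positivity)).mpr hk2
  have hs2 : Real.sqrt (k * ν) ^ 2 = k * ν := Real.sq_sqrt (by positivity)
  unfold stepConst velBound
  generalize Real.sqrt (k * ν) = s at hs0 hs1 hs2
  rw [lt_div_iff₀ (by positivity)] at hs1
  have hs3 : s ≤ 1 := by nlinarith
  have hke : k = s ^ 2 / ν := by field_simp; linarith
  have b1 : s * (2 * latticeSum / ν ^ 2) ≤ s * P := by
    gcongr
    rw [hP]
    exact le_add_of_nonneg_right (by positivity)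
  have b2 : s * (8 / ν ^ 2 * (2 * latticeSum * (A + G)
      + 2 * latticeSum ^ 2 * A ^ 2 / ν ^ 2)) ≤ s * P := by
    gcongr
    rw [hP]
    exact le_add_of_nonneg_left (by positivity)
  refine ⟨hk1, ?_, ?_⟩
  · have e : k ^ 2 * s⁻¹ ^ 3 * (2 * latticeSum) = s * (2 * latticeSum / ν ^ 2) := by
      rw [hke]; field_simp
    rw [e]
    nlinarith
  · have hkk : k ^ 2 ≤ 1 := pow_le_one₀ hk.le hk1
    have e : 2 * k / ν * (4 * (s⁻¹ * latticeSum * (2 * (A + k ^ 2 * G))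
        + k ^ 2 * s⁻¹ ^ 4 * latticeSum * (2 * latticeSum * (A * A))))
        = s * (8 / ν ^ 2 * (2 * latticeSum * (A + k ^ 2 * G)
          + s * (2 * latticeSum ^ 2 * A ^ 2 / ν ^ 2))) := by
      generalize hK : k ^ 2 * G = K
      rw [hke]
      field_simp
      ring
    rw [e]
    have h1 : k ^ 2 * G ≤ 1 * G := by gcongr
    have h2 : s * (2 * latticeSum ^ 2 * A ^ 2 / ν ^ 2)
        ≤ 1 * (2 * latticeSum ^ 2 * A ^ 2 / ν ^ 2) := by gcongr
    rw [one_mul] at h1 h2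
    calc _ ≤ s * (8 / ν ^ 2 * (2 * latticeSum * (A + G)
          + 2 * latticeSum ^ 2 * A ^ 2 / ν ^ 2)) := by gcongr
      _ ≤ 1 := by nlinarith


section LongTime

variable {ν k F : ℝ} {fn ω : ℕ → L2dot}

/-- The bound of the squared norm after the first step, for which only the crude estimate of the
transport term is available. -/
noncomputable def firstStepBound (F r : ℝ) : ℝ := 3 * (r ^ 2 + F ^ 2 + 2 * (r ^ 2 * r ^ 2))

lemma firstStepBound_nonneg (F r : ℝ) : 0 ≤ firstStepBound F r := by
  unfold firstStepBound
  positivity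

/-- The bound of the squared norm for all times. -/
noncomputable def uniformBound (ν F r : ℝ) : ℝ := firstStepBound F r + 2 * F ^ 2 / ν ^ 2

lemma uniformBound_nonneg (ν F r : ℝ) : 0 ≤ uniformBound ν F r := by
  have := firstStepBound_nonneg F r
  unfold uniformBound
  positivity

/-- The squared `L²` norm of the gradient of the vorticity, which is `0` by convention outside
`H¹`. -/
noncomputable def gradNormSq (u : L2) : ℝ := (gradSq (hat u)).toReal

lemma gradNormSq_nonneg (u : L2) : 0 ≤ gradNormSq u := ENNReal.toReal_nonneg

lemma toReal_normSq_hat (u : L2) : (normSq (hat u)).toReal = ‖u‖ ^ 2 := by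
  rw [normSq_hat, ENNReal.toReal_ofReal (by positivity)]

lemma normSq_hat_le {u : L2} {C : ℝ} (h : ‖u‖ ≤ C) :
    normSq (hat u) ≤ ENNReal.ofReal (C ^ 2) := by
  rw [normSq_hat]
  gcongr

lemma norm_sq_first_step_le (hν : 0 < ν) (hk : 0 < k) (hk1 : k ≤ 1) (hc : stepConst ν k ≤ 1)
    {g ω ω' : L2dot} (hg : ‖g‖ ≤ F) (h : hat ω' = schemeStep ν k (hat g) (hat ω)) :
    ‖ω'‖ ^ 2 ≤ firstStepBound F ‖ω‖ := by
  have h0 : ∀ m, hat ((0 : L2dot) : L2) m = 0 := fun m => by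
    simpa using hat_sub (0 : L2) 0 m
  have hz : hat ((0 : L2dot) : L2) = schemeStep ν k (hat ((0 : L2dot) : L2))
      (hat ((0 : L2dot) : L2)) := by
    rw [show hat ((0 : L2dot) : L2) = 0 from funext h0, schemeStep_zero]
  have key := norm_sub_sq_le_of_hat_eq hν hk h hz
  simp only [sub_zero, norm_zero, ne_eq, OfNat.ofNat_ne_zero, not_false_eq_true, zero_pow,
    add_zero] at key
  refine key.trans ?_
  unfold firstStepBound
  have h1 : k ^ 2 * ‖g‖ ^ 2 ≤ 1 * F ^ 2 := by
    gcongr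
    exact pow_le_one₀ hk.le hk1
  have h2 : 2 * stepConst ν k * (‖ω‖ ^ 2 * ‖ω‖ ^ 2) ≤ 2 * 1 * (‖ω‖ ^ 2 * ‖ω‖ ^ 2) := by gcongr
  linarith

/-- The energy inequality, from the second step on. The velocity in the transport term is controlled
by the preceding iterate. -/
lemma energy_le (hν : 0 < ν) (hk : 0 < k) {A : ℝ} (hA : 0 ≤ A)
    (hsmall : 2 * k / ν * velBound ν k A (F ^ 2) ≤ 1) {g g' ω ω' ω'' : L2dot} (hg : ‖g‖ ≤ F)
    (hg' : ‖g'‖ ≤ F) (hω : ‖ω‖ ^ 2 ≤ A) (h : hat ω' = schemeStep ν k (hat g) (hat ω))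
    (h' : hat ω'' = schemeStep ν k (hat g') (hat ω')) :
    gradSq (hat ω'') ≠ ⊤ ∧
      ‖ω''‖ ^ 2 + k * ν * gradNormSq ω'' ≤ ‖ω'‖ ^ 2 + 2 * k / ν * F ^ 2 := by
  have hv := velSum_schemeStep_sq_le (g := hat (g : L2)) (a := hat (ω : L2)) hν hk hA (sq_nonneg F)
    ((normSq_hat (ω : L2)).trans_le (ENNReal.ofReal_le_ofReal hω)) (normSq_hat_le hg)
  rw [← h] at hv
  have hvt : velSum (hat ω') ≠ ⊤ := by
    intro htop
    rw [htop] at hv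
    simp at hv
  have hvb : (velSum (hat ω')).toReal ^ 2 ≤ max 0 (velBound ν k A (F ^ 2)) := by
    rw [← ENNReal.toReal_pow, max_comm, ← ENNReal.toReal_ofReal']
    exact ENNReal.toReal_mono ENNReal.ofReal_ne_top hv
  have hsm : 2 * k / ν * (velSum (hat ω')).toReal ^ 2 ≤ 1 := by
    have h0 : 0 ≤ 2 * k / ν := by positivity
    refine (mul_le_mul_of_nonneg_left hvb h0).trans ?_
    rcases max_cases 0 (velBound ν k A (F ^ 2)) with ⟨e, _⟩ | ⟨e, _⟩
    · rw [e, mul_zero]; exact zero_le_one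
    · rw [e]; exact hsmall
  have hgf := gradSq_schemeStep_ne_top hν hk (normSq_hat_ne_top (ω' : L2))
    (normSq_hat_ne_top (g' : L2)) hvt
  have key := normSq_add_gradSq_schemeStep_le hν hk (hat_neg (ω' : L2)) (hat_coe_zero ω')
    (hat_coe_zero g') (normSq_hat_ne_top _) (normSq_hat_ne_top _) hvt hsm
  rw [← h'] at hgf key
  refine ⟨hgf, ?_⟩
  simp only [toReal_normSq_hat] at key
  refine key.trans ?_
  have : ‖(g' : L2)‖ ^ 2 ≤ F ^ 2 := pow_le_pow_left₀ (norm_nonneg _) hg' 2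
  have h3 : 2 * k / ν * ‖(g' : L2)‖ ^ 2 ≤ 2 * k / ν * F ^ 2 := by gcongr
  exact add_le_add le_rfl h3

lemma norm_sq_le_gradNormSq {u : L2dot} (h : gradSq (hat u) ≠ ⊤) : ‖u‖ ^ 2 ≤ gradNormSq u := by
  have h1 := ENNReal.toReal_mono h (normSq_le_gradSq (hat_coe_zero u))
  rwa [toReal_normSq_hat] at h1

lemma gradNormSq_step_le (hν : 0 < ν) (hk : 0 < k) {g ω ω' : L2dot} (hg : ‖g‖ ≤ F)
    (hω : gradSq (hat ω) ≠ ⊤) (h : hat ω' = schemeStep ν k (hat g) (hat ω)) :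
    gradNormSq ω' ≤ gradNormSq ω + k / ν * (2 * (F ^ 2 + latticeSum * gradNormSq ω ^ 2)) := by
  have key := gradSq_schemeStep_le hν hk (hat g) (hat ω)
  have hl := latticeSum_nonneg
  have hd := gradNormSq_nonneg (ω : L2)
  have e : gradSq (hat ω) = ENNReal.ofReal (gradNormSq ω) := (ENNReal.ofReal_toReal hω).symm
  rw [← h, e] at key
  have h2 : gradSq (hat ω') ≤ ENNReal.ofReal (gradNormSq ω
      + k / ν * (2 * (F ^ 2 + latticeSum * gradNormSq ω ^ 2))) := by
    refine key.trans ?_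
    rw [ENNReal.ofReal_add hd (by positivity), ENNReal.ofReal_mul (p := k / ν) (by positivity),
      ENNReal.ofReal_mul (p := 2) (by norm_num), ENNReal.ofReal_ofNat,
      ENNReal.ofReal_add (by positivity) (by positivity), ENNReal.ofReal_mul hl,
      ENNReal.ofReal_pow hd]
    gcongr
    exact normSq_hat_le hg
  have h3 := ENNReal.toReal_mono ENNReal.ofReal_ne_top h2
  rwa [ENNReal.toReal_ofReal (by positivity)] at h3

/-- The iterates decay to an absorbing ball of `L²`. -/
lemma norm_sq_le_of_small_step (hν : 0 < ν) (hk : 0 < k) (hk1 : k ≤ 1)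
    (hc : stepConst ν k ≤ 1)
    (hsmall : 2 * k / ν * velBound ν k (uniformBound ν F ‖ω 0‖) (F ^ 2) ≤ 1)
    (hfn : ∀ n, ‖fn n‖ ≤ F)
    (hω : ∀ n, hat (ω (n + 1)) = schemeStep ν k (hat (fn n)) (hat (ω n))) (n : ℕ) :
    ‖ω n‖ ^ 2 ≤ uniformBound ν F ‖ω 0‖ ∧
      ‖ω (n + 1)‖ ^ 2 ≤ firstStepBound F ‖ω 0‖ / (1 + k * ν) ^ n + 2 * F ^ 2 / ν ^ 2 := by
  have hR := firstStepBound_nonneg F ‖ω 0‖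
  have hM := uniformBound_nonneg ν F ‖ω 0‖
  induction n with
  | zero =>
    have h1 := norm_sq_first_step_le hν hk hk1 hc (hfn 0) (hω 0)
    have h2 : 0 ≤ 2 * F ^ 2 / ν ^ 2 := by positivity
    refine ⟨?_, by rw [pow_zero, div_one]; linarith⟩
    unfold uniformBound firstStepBound
    nlinarith [sq_nonneg ‖ω 0‖, sq_nonneg F, sq_nonneg (‖ω 0‖ ^ 2)]
  | succ n ih =>
    have h1 : firstStepBound F ‖ω 0‖ / (1 + k * ν) ^ n ≤ firstStepBound F ‖ω 0‖ :=
      div_le_self hR (one_le_pow₀ (by nlinarith [mul_pos hk hν]))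
    refine ⟨ih.2.trans (add_le_add h1 le_rfl), ?_⟩
    obtain ⟨h2, h3⟩ := energy_le hν hk hM hsmall (hfn n) (hfn (n + 1)) ih.1 (hω n) (hω (n + 1))
    have h4 := norm_sq_le_gradNormSq h2
    have hx : 0 < k * ν := by positivity
    have h5 : (1 + k * ν) * ‖ω (n + 1 + 1)‖ ^ 2 ≤ (1 + k * ν)
        * (firstStepBound F ‖ω 0‖ / (1 + k * ν) ^ (n + 1) + 2 * F ^ 2 / ν ^ 2) := by
      have e : (1 + k * ν) * (firstStepBound F ‖ω 0‖ / (1 + k * ν) ^ (n + 1) + 2 * F ^ 2 / ν ^ 2)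
          = firstStepBound F ‖ω 0‖ / (1 + k * ν) ^ n + 2 * F ^ 2 / ν ^ 2
            + 2 * k / ν * F ^ 2 := by
        field_simp
        ring
      have h6 := mul_le_mul_of_nonneg_left h4 hx.le
      rw [e, one_add_mul]
      linarith [ih.2]
    exact le_of_mul_le_mul_left h5 (by positivity)

/-- The squared radius of an absorbing ball in `L²`. -/
noncomputable def absorbingL2 (ν F : ℝ) : ℝ := 1 + 2 * F ^ 2 / ν ^ 2

/-- The bound of the sum of `k ‖∇ω‖²` over a window of length at most `2`. -/
noncomputable def windowBound (ν F : ℝ) : ℝ := (absorbingL2 ν F + 4 * F ^ 2 / ν) / ν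

/-- The squared radius of an absorbing ball in `H¹`. -/
noncomputable def absorbingH1 (ν F : ℝ) : ℝ :=
  absorbingL2 ν F + (windowBound ν F + 2 * (2 * F ^ 2 / ν))
    * Real.exp (2 * latticeSum / ν * windowBound ν F)

/-- The iterates enter an absorbing ball of `H¹` after a time that depends on the data. -/
lemma h1NormLE_of_small_step (hν : 0 < ν) (hk : 0 < k) (hk1 : k ≤ 1)
    (hc : stepConst ν k ≤ 1)
    (hsmall : 2 * k / ν * velBound ν k (uniformBound ν F ‖ω 0‖) (F ^ 2) ≤ 1)
    (hfn : ∀ n, ‖fn n‖ ≤ F)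
    (hω : ∀ n, hat (ω (n + 1)) = schemeStep ν k (hat (fn n)) (hat (ω n))) {n : ℕ}
    (hn : firstStepBound F ‖ω 0‖ / ν + 5 ≤ n * k) :
    H1NormLE (ω n) (Real.sqrt (absorbingH1 ν F)) := by
  have hR := firstStepBound_nonneg F ‖ω 0‖
  have hM := uniformBound_nonneg ν F ‖ω 0‖
  have hl := latticeSum_nonneg
  have hall := norm_sq_le_of_small_step hν hk hk1 hc hsmall hfn hω
  have hen := fun j => energy_le hν hk hM hsmall (hfn j) (hfn (j + 1)) (hall j).1 (hω j)
    (hω (j + 1))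
  have hρ0 : 0 ≤ absorbingL2 ν F := by unfold absorbingL2; positivity
  have hW0 : 0 ≤ windowBound ν F := by unfold windowBound; positivity
  -- Bernoulli's inequality turns the geometric decay into an explicit entrance time.
  have hball : ∀ j : ℕ, firstStepBound F ‖ω 0‖ / ν ≤ j * k → ‖ω (j + 1)‖ ^ 2 ≤ absorbingL2 ν F := by
    intro j hj
    refine (hall j).2.trans ?_
    unfold absorbingL2
    gcongr
    have hb := one_add_mul_le_pow (a := k * ν) (by nlinarith [mul_pos hk hν]) j
    rw [div_le_iff₀ hν] at hj
    rw [div_le_one (by positivity)]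
    linarith
  -- The window has `p` steps, where `p k` is between `1` and `2`.
  set p := ⌈1 / k⌉₊ with hp
  have hp1 : 1 ≤ p * k := (div_le_iff₀ hk).mp (Nat.le_ceil (1 / k))
  have hp2 : p * k ≤ 2 := by
    have := (Nat.ceil_lt_add_one (by positivity : 0 ≤ 1 / k)).le
    calc (p : ℝ) * k ≤ (1 / k + 1) * k := by gcongr
      _ = 1 + k := by field_simp
      _ ≤ 2 := by linarith
  have hdiv : 0 ≤ firstStepBound F ‖ω 0‖ / ν := by positivity
  obtain ⟨j, rfl⟩ : ∃ j, n = j + 1 + 1 + p := by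
    have : p + 2 ≤ n := by
      have : ((p + 2 : ℕ) : ℝ) * k ≤ n * k := by push_cast; nlinarith
      exact_mod_cast le_of_mul_le_mul_right this hk
    exact ⟨n - (p + 2), by omega⟩
  push_cast at hn
  have hj : firstStepBound F ‖ω 0‖ / ν ≤ j * k := by nlinarith
  have hw := sum_grad_le (E := fun i => ‖ω i‖ ^ 2) (d := fun i => gradNormSq (ω i)) (k := k)
    (ν := ν) (G := F ^ 2) (N := j + 1) (fun i hi => by
      obtain ⟨l, rfl⟩ := Nat.exists_eq_add_of_le' (le_trans (Nat.le_add_left 1 j) hi)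
      exact (hen l).2) p
  have hsum : k * ∑ i ∈ Finset.range p, gradNormSq (ω (j + 1 + 1 + i)) ≤ windowBound ν F := by
    rw [windowBound, le_div_iff₀ hν]
    have h1 := hball j hj
    have h2 : (p : ℝ) * (2 * k / ν * F ^ 2) = p * k * (2 * F ^ 2 / ν) := by ring
    have h3 : (p : ℝ) * k * (2 * F ^ 2 / ν) ≤ 2 * (2 * F ^ 2 / ν) := by gcongr
    have h4 : 2 * (2 * F ^ 2 / ν) = 4 * F ^ 2 / ν := by ring
    have h5 := sq_nonneg ‖ω (j + 1 + p)‖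
    have h6 : k * (∑ i ∈ Finset.range p, gradNormSq (ω (j + 1 + 1 + i))) * ν
        = k * ν * ∑ i ∈ Finset.range p, gradNormSq (ω (j + 1 + 1 + i)) := by ring
    rw [h6]
    linarith
  have hgron := uniform_gronwall (d := fun i => gradNormSq (ω (j + 1 + 1 + i))) (k := k)
    (α := 2 * latticeSum / ν) (β := 2 * F ^ 2 / ν) (R := windowBound ν F) (p := p)
    (fun i => gradNormSq_nonneg _) hk (by positivity) (by positivity) hW0 hp1 hp2 (fun i => by
      have hfin : gradSq (hat (ω (j + 1 + 1 + i))) ≠ ⊤ := by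
        have := (hen (j + i)).1
        rwa [show j + i + 1 + 1 = j + 1 + 1 + i by ring] at this
      have h := gradNormSq_step_le hν hk (hfn _) hfin (hω (j + 1 + 1 + i))
      refine h.trans_eq ?_
      ring) hsum
  have hfin : gradSq (hat (ω (j + 1 + 1 + p))) ≠ ⊤ := by
    have := (hen (j + p)).1
    rwa [show j + p + 1 + 1 = j + 1 + 1 + p by ring] at this
  have hs := hasSum_freqSq_mul_norm_sq hfin
  refine h1NormLE_of_summable hs.summable (Real.sqrt_nonneg _) ?_
  rw [hs.tsum_eq, Real.sq_sqrt (by unfold absorbingH1; positivity)]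
  have hlast := hball (j + 1 + p) (by push_cast; nlinarith)
  rw [show j + 1 + p + 1 = j + 1 + 1 + p by ring] at hlast
  exact add_le_add hlast hgron

end LongTime

/-- The stability statement with all constants chosen for given data. -/
lemma exists_stability_bounds (ν F : ℝ) (hν : 0 < ν) (r : ℝ) :
    ∃ k₀ > 0, ∀ ω₀ : L2dot, ‖ω₀‖ = r → ∀ k : ℝ, 0 < k → k < k₀ →
      ∀ fn : ℕ → L2dot, (∀ n, ‖fn n‖ ≤ F) →
      ∀ ω : ℕ → L2dot, ω 0 = ω₀ → IsSchemeSolution ν k fn ω →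
        (∀ n, ‖ω n‖ ≤ Real.sqrt (uniformBound ν F r)) ∧
        ∀ n : ℕ, firstStepBound F r / ν + 5 ≤ n * k →
          H1NormLE (ω n) (Real.sqrt (absorbingH1 ν F)) := by
  obtain ⟨k₀, hk₀, h⟩ := exists_time_step hν (uniformBound_nonneg ν F r) (sq_nonneg F)
  refine ⟨k₀, hk₀, fun ω₀ hr k hk hkk fn hfn ω h0 hsol => ?_⟩
  obtain ⟨hk1, hc, hsmall⟩ := h k hk hkk
  have hω : ∀ n, hat (ω (n + 1)) = schemeStep ν k (hat (fn n)) (hat (ω n)) := fun n =>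
    (isSchemeStep_iff_hat_eq hν hk _ _ _).mp (hsol n)
  subst h0 hr
  exact ⟨fun n => Real.le_sqrt_of_sq_le
      (norm_sq_le_of_small_step hν hk hk1 hc hsmall hfn hω n).1,
    fun n hn => h1NormLE_of_small_step hν hk hk1 hc hsmall hfn hω hn⟩

end TorusNSE

theorem theorem2p6 :
    -- the scheme defines a discrete dynamical system on mean-zero `L²`, for every time step
    (∀ ν k : ℝ, 0 < ν → 0 < k →
      (∃ S : TorusNSE.L2dot × TorusNSE.L2dot → TorusNSE.L2dot, Continuous S ∧
        ∀ g ω ω' : TorusNSE.L2dot, TorusNSE.IsSchemeStep ν k g ω ω' ↔ ω' = S (ω, g)) ∧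
      (∀ g : TorusNSE.L2dot, ∃ Φ : Flow ℕ TorusNSE.L2dot, ∀ ω₀ : TorusNSE.L2dot,
        TorusNSE.IsSchemeSolution ν k (fun _ => g) (fun n => Φ n ω₀))) ∧
    -- long time stability in `L²` and `H¹`
    (∃ (k₀ M₀ T : ℝ → ℝ → ℝ → ℝ) (M₁ : ℝ → ℝ → ℝ),
      ∀ ν : ℝ, 0 < ν → ∀ f : ℝ → TorusNSE.L2dot, TorusNSE.IsForcing f →
      ∀ ω₀ : TorusNSE.L2dot,
        0 < k₀ ‖ω₀‖ ν (TorusNSE.forcingNorm f) ∧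
        ∀ k : ℝ, 0 < k → k < k₀ ‖ω₀‖ ν (TorusNSE.forcingNorm f) →
        ∀ fn : ℕ → TorusNSE.L2dot, (∀ n, ‖fn n‖ ≤ TorusNSE.forcingNorm f) →
        ∀ ω : ℕ → TorusNSE.L2dot, ω 0 = ω₀ → TorusNSE.IsSchemeSolution ν k fn ω →
          (∀ n, ‖ω n‖ ≤ M₀ ‖ω₀‖ ν (TorusNSE.forcingNorm f)) ∧
          (∀ n : ℕ, T ‖ω₀‖ ν (TorusNSE.forcingNorm f) ≤ n * k →
            TorusNSE.H1NormLE (ω n) (M₁ ν (TorusNSE.forcingNorm f)))) := by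
  refine ⟨fun ν k hν hk => ⟨TorusNSE.exists_continuous_step hν hk,
    TorusNSE.exists_flow hν hk⟩, ?_⟩
  choose k₀ hk₀ h using TorusNSE.exists_stability_bounds
  -- The time step is only provided for positive viscosity; elsewhere its value is irrelevant.
  classical
  refine ⟨fun r ν F => if h : 0 < ν then k₀ ν F h r else 1,
    fun r ν F => Real.sqrt (TorusNSE.uniformBound ν F r),
    fun r ν F => TorusNSE.firstStepBound F r / ν + 5,
    fun ν F => Real.sqrt (TorusNSE.absorbingH1 ν F), fun ν hν f _ ω₀ => ?_⟩
  beta_reduce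
  rw [dif_pos hν]
  exact ⟨hk₀ ν _ hν _, h ν _ hν _ ω₀ rfl⟩
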